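/- Let $G$ be a unimodular, locally compact, second-countable Hausdorff group with identity $e$ and Haar measure $m$ (written $\mathrm{d}x$). Let $\sigma\colon G\times G\to\mathbb{T}$ be a continuous 2-cocycle, i.e. $\sigma(x,y)\sigma(xy,z)=\sigma(x,yz)\sigma(y,z)$ for all $x,y,z\in G$ and $\sigma(e,e)=1$ (the untwisted case is $\sigma\equiv 1$). **Covolumes.** A set $\Lambda\subseteq G$ is *relatively separated* if $\sup_{x\in G}|\Lambda\cap xU|<\infty$ for some nonempty open $U\subseteq G$; such a set is closed. Give the set $\mathcal{C}(G)$ of closed subsets of $G$ the Chabauty–Fell topology, with subbasis the sets $\{C: C\cap K=\emptyset\}$ ($K$ compact) and $\{C: C\cap V\neq\emptyset\}$ ($V$ open). For relatively separated $\Lambda$, let $\Omega(\Lambda)$ be the closure of $\{x\Lambda : x\in G\}$ in $\mathcal{C}(G)$, let $\Omega^\times(\Lambda)=\Omega(\Lambda)\setminus\{\emptyset\}$ be the punctured hull and $\Omega_0(\Lambda)=\{P\in\Omega(\Lambda): e\in P\}$ the transversal. For a Borel probability measure $\mu$ on $\Omega^\times(\Lambda)$ that is invariant under left translation, let $\mu_0$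 be its transverse measure, the unique measure on $\Omega_0(\Lambda)$ with $$\int_{\Omega^\times(\Lambda)}\sum_{x\in P}F(x,x^{-1}P)\,\mathrm{d}\mu(P)=\int_{\Omega_0(\Lambda)}\int_G F(x,Q)\,\mathrm{d}x\,\mathrm{d}\mu_0(Q),\qquad F\in C_c(G\times\Omega_0(\Lambda)),$$ and set $\operatorname{covol}_\mu(\Lambda)=\mu(\Omega^\times(\Lambda))/\mu_0(\Omega_0(\Lambda))$. Let $\operatorname{covol}_-(\Lambda)$ and $\operatorname{covol}_+(\Lambda)$ be the infimum and the supremum of $\operatorname{covol}_\mu(\Lambda)$ over all such $\mu$; if there is no such $\mu$, then $\operatorname{covol}_-(\Lambda)=\infty$ and $\operatorname{covol}_+(\Lambda)=0$. **Theorem.** Let $\mathcal{H}\neq\{0\}$ be a reproducing kernel Hilbert space of complex-valued functions on $G$, and for $x\in G$ let $k_x\in\mathcal{H}$ be the kernel at $x$, i.e. $f(x)=\langle f,k_x\rangle$ for all $f\in\mathcal{H}$. Suppose that (a) $\mathcal{H}$ is isometrically embedded into $L^2(G)$; (b) for every $f\in\mathcal{H}$ and $x\in G$, the function $y\mapsto\sigma(x,x^{-1}y)f(x^{-1}y)$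 is in $\mathcal{H}$; (c) for some compact neighborhood $Q$ of $e$, $\int_G\sup_{t\in xQ}|f(t)|^2\,\mathrm{d}x<\infty$ for all $f\in\mathcal{H}$. Let $\Lambda\subseteq G$ be an arbitrary subset. (i) If $\Lambda$ is a set of sampling for $\mathcal{H}$, i.e. there are $A,B>0$ with $A\|f\|^2\le\sum_{\lambda\in\Lambda}|f(\lambda)|^2\le B\|f\|^2$ for all $f\in\mathcal{H}$, then $\Lambda$ is relatively separated and $\|k_e\|^2\operatorname{covol}_+(\Lambda)\le 1$. (ii) If $\Lambda$ is a set of interpolation for $\mathcal{H}$, i.e. for every $(c_\lambda)_{\lambda\in\Lambda}\in\ell^2(\Lambda)$ there is $f\in\mathcal{H}$ with $f(\lambda)=c_\lambda$ for all $\lambda\in\Lambda$, then $\Lambda$ is relatively separated and $\|k_e\|^2\operatorname{covol}_-(\Lambda)\ge 1$. -/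

import Mathlib

open MeasureTheory Set Filter Topology
open scoped ENNReal NNReal Pointwise CompactlySupported

noncomputable section

/-! ### The space of closed subsets of a topological group -/

/-- The set `𝒞(G)` of closed subsets of `G`. It is a synonym of `TopologicalSpace.Closeds G`, which
carries the Chabauty–Fell topology below (and no other topology). -/
def ClosedSubsets (G : Type*) [TopologicalSpace G] : Type _ := TopologicalSpace.Closeds G

namespace ClosedSubsets

instance instSetLike (G : Type*) [TopologicalSpace G] : SetLike (ClosedSubsets G) G :=
  inferInstanceAs (SetLike (TopologicalSpace.Closeds G) G)

/-- The Chabauty–Fell topology: the sets `{C | C ∩ K = ∅}` with `K` compact and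
`{C | C ∩ V ≠ ∅}` with `V` open form a subbasis. -/
instance instTopologicalSpace (G : Type*) [TopologicalSpace G] :
    TopologicalSpace (ClosedSubsets G) :=
  TopologicalSpace.generateFrom
    ({O | ∃ K : Set G, IsCompact K ∧ O = {C : ClosedSubsets G | (C : Set G) ∩ K = ∅}} ∪
      {O | ∃ V : Set G, IsOpen V ∧ O = {C : ClosedSubsets G | ((C : Set G) ∩ V).Nonempty}})

instance instMeasurableSpace (G : Type*) [TopologicalSpace G] :
    MeasurableSpace (ClosedSubsets G) := borel _

instance instBorelSpace (G : Type*) [TopologicalSpace G] : BorelSpace (ClosedSubsets G) := ⟨rfl⟩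

theorem isClosed_coe {G : Type*} [TopologicalSpace G] (C : ClosedSubsets G) :
    IsClosed (C : Set G) :=
  TopologicalSpace.Closeds.isClosed (α := G) C

/-- A subset of `G` as a point of `𝒞(G)`: its closure (for a closed set, the set itself). -/
def ofSet {G : Type*} [TopologicalSpace G] (S : Set G) : ClosedSubsets G :=
  (⟨closure S, isClosed_closure⟩ : TopologicalSpace.Closeds G)

@[simp]
theorem coe_ofSet {G : Type*} [TopologicalSpace G] (S : Set G) :
    (ofSet S : Set G) = closure S := rfl

/-- The action of `G` on `𝒞(G)` by left translation, `x • C = {x y | y ∈ C}`. -/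
instance instSMul (G : Type*) [Group G] [TopologicalSpace G] [IsTopologicalGroup G] :
    SMul G (ClosedSubsets G) where
  smul x C := (⟨x • (C : Set G), C.isClosed_coe.smul x⟩ : TopologicalSpace.Closeds G)

@[simp]
theorem coe_smul {G : Type*} [Group G] [TopologicalSpace G] [IsTopologicalGroup G]
    (x : G) (C : ClosedSubsets G) : ((x • C : ClosedSubsets G) : Set G) = x • (C : Set G) := rfl

instance instMulAction (G : Type*) [Group G] [TopologicalSpace G] [IsTopologicalGroup G] :
    MulAction G (ClosedSubsets G) where
  one_smul C := SetLike.coe_injective (by simp)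
  mul_smul x y C := SetLike.coe_injective (by simp [mul_smul])

theorem continuous_const_smul {G : Type*} [Group G] [TopologicalSpace G] [IsTopologicalGroup G]
    (x : G) : Continuous (fun C : ClosedSubsets G => x • C) := by
  refine continuous_generateFrom_iff.2 ?_
  rintro O (⟨K, hK, rfl⟩ | ⟨V, hV, rfl⟩)
  · refine TopologicalSpace.isOpen_generateFrom_of_mem
      (Or.inl ⟨x⁻¹ • K, hK.smul x⁻¹, ?_⟩)
    ext C
    have h : x • (C : Set G) ∩ K = x • ((C : Set G) ∩ x⁻¹ • K) := by
      rw [Set.smul_set_inter, smul_inv_smul]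
    simp [h]
  · refine TopologicalSpace.isOpen_generateFrom_of_mem
      (Or.inr ⟨x⁻¹ • V, hV.smul x⁻¹, ?_⟩)
    ext C
    have h : x • (C : Set G) ∩ V = x • ((C : Set G) ∩ x⁻¹ • V) := by
      rw [Set.smul_set_inter, smul_inv_smul]
    simp [h]

end ClosedSubsets

/-! ### Point sets, hulls and covolumes -/

section Hull

variable {G : Type*} [Group G] [TopologicalSpace G]

/-- `Λ` is relatively separated: for some nonempty open `U`, the number of points of `Λ` in a left
translate of `U` is bounded. -/
def IsRelativelySeparated (Λ : Set G) : Prop :=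
  ∃ U : Set G, IsOpen U ∧ U.Nonempty ∧ ∃ ℓ : ℕ, ∀ x : G, (Λ ∩ x • U).encard ≤ ℓ

variable [IsTopologicalGroup G]

/-- The hull of `Λ`: the orbit closure of `Λ` in `𝒞(G)`. (Relatively separated sets are closed; for
a set that is not closed, this is the hull of its closure.) -/
def hull (Λ : Set G) : Set (ClosedSubsets G) :=
  closure (range fun x : G => x • ClosedSubsets.ofSet Λ)

theorem smul_mem_hull {Λ : Set G} {P : ClosedSubsets G} (hP : P ∈ hull Λ) (y : G) :
    y • P ∈ hull Λ := by
  refine map_mem_closure (ClosedSubsets.continuous_const_smul y) hP ?_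
  rintro _ ⟨x, rfl⟩
  exact ⟨y * x, mul_smul y x _⟩

/-- The punctured hull of `Λ`: the hull without the empty set. -/
def puncturedHull (Λ : Set G) : Set (ClosedSubsets G) :=
  {P | P ∈ hull Λ ∧ (P : Set G).Nonempty}

/-- The transversal of `Λ`: the members of the hull that contain the identity. -/
def transversal (Λ : Set G) : Set (ClosedSubsets G) :=
  {P | P ∈ hull Λ ∧ (1 : G) ∈ P}

theorem smul_mem_puncturedHull {Λ : Set G} {P : ClosedSubsets G} (hP : P ∈ puncturedHull Λ)
    (y : G) : y • P ∈ puncturedHull Λ :=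
  ⟨smul_mem_hull hP.1 y, by simpa using hP.2⟩

/-- The action of `G` on the punctured hull by left translation. -/
instance puncturedHull.instMulAction (Λ : Set G) : MulAction G (puncturedHull Λ) where
  smul x P := ⟨x • (P : ClosedSubsets G), smul_mem_puncturedHull P.2 x⟩
  one_smul P := Subtype.ext (one_smul G (P : ClosedSubsets G))
  mul_smul x y P := Subtype.ext (mul_smul x y (P : ClosedSubsets G))

/-- For `P` in the punctured hull and `x ∈ P`, the member `x⁻¹ P` of the transversal. -/
def puncturedHull.toTransversal {Λ : Set G} (P : puncturedHull Λ)
    (x : (P : ClosedSubsets G)) : transversal Λ :=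
  ⟨(x : G)⁻¹ • (P : ClosedSubsets G), smul_mem_hull P.2.1 _, by
    change (1 : G) ∈ (x : G)⁻¹ • ((P : ClosedSubsets G) : Set G)
    rw [Set.mem_inv_smul_set_iff, smul_eq_mul, mul_one]
    exact x.2⟩

variable [MeasurableSpace G]

/-- `μ₀` is a transverse measure of `μ` (with respect to the Haar measure `m`):
`∫ ∑_{x ∈ P} F (x, x⁻¹ P) dμ(P) = ∫ ∫ F (x, Q) dm(x) dμ₀(Q)` for all `F ∈ C_c(G × transversal Λ)`.
By linearity it suffices to consider `F ≥ 0`, for which all the integrals and sums make sense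
in `[0, ∞]`. -/
def IsTransverseMeasure (m : Measure G) (Λ : Set G) (μ : Measure (puncturedHull Λ))
    (μ₀ : Measure (transversal Λ)) : Prop :=
  ∀ F : C_c(G × transversal Λ, ℝ≥0),
    ∫⁻ P, ∑' x : (P : ClosedSubsets G), (F ((x : G), puncturedHull.toTransversal P x) : ℝ≥0∞) ∂μ =
      ∫⁻ Q, ∫⁻ x, (F (x, Q) : ℝ≥0∞) ∂m ∂μ₀

open Classical in
/-- The transverse measure of `μ`. It exists and is unique for every finite invariant measure `μ` if
`Λ` is relatively separated; where there is none, the value is `0`. -/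
def transverseMeasure (m : Measure G) (Λ : Set G) (μ : Measure (puncturedHull Λ)) :
    Measure (transversal Λ) :=
  if h : ∃ μ₀, IsTransverseMeasure m Λ μ μ₀ then h.choose else 0

/-- The covolume of `Λ` with respect to `μ`. -/
def covolume (m : Measure G) (Λ : Set G) (μ : Measure (puncturedHull Λ)) : ℝ≥0∞ :=
  μ univ / transverseMeasure m Λ μ univ

/-- The `G`-invariant Borel probability measures on the punctured hull of `Λ`. -/
def invariantProbabilityMeasures (Λ : Set G) : Set (Measure (puncturedHull Λ)) :=
  {μ | IsProbabilityMeasure μ ∧ SMulInvariantMeasure G (puncturedHull Λ) μ}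

/-- The lower covolume; it is `∞` if there are no invariant probability measures. -/
def lowerCovolume (m : Measure G) (Λ : Set G) : ℝ≥0∞ :=
  ⨅ μ ∈ invariantProbabilityMeasures Λ, covolume m Λ μ

/-- The upper covolume; it is `0` if there are no invariant probability measures. -/
def upperCovolume (m : Measure G) (Λ : Set G) : ℝ≥0∞ :=
  ⨆ μ ∈ invariantProbabilityMeasures Λ, covolume m Λ μ

end Hull

/-! ### Reproducing kernel Hilbert spaces on a group -/

section RKHSOnGroup

/-- Continuous 2-cocycles `σ : G × G → 𝕋` with `σ(e, e) = 1`. -/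
structure IsContinuousTwoCocycle {G : Type*} [Group G] [TopologicalSpace G]
    (σ : G → G → Circle) : Prop where
  continuous : Continuous (Function.uncurry σ)
  cocycle : ∀ x y z : G, σ x y * σ (x * y) z = σ x (y * z) * σ y z
  map_one_one : σ 1 1 = 1

/-- The `σ`-twisted left translation `y ↦ σ(x, x⁻¹ y) f(x⁻¹ y)` of a function `f`. -/
def twistedTranslate {G : Type*} [Group G] (σ : G → G → Circle) (x : G) (f : G → ℂ) : G → ℂ :=
  fun y => (σ x (x⁻¹ * y) : ℂ) * f (x⁻¹ * y)

variable {G : Type*} [Group G] (H : Type*) [NormedAddCommGroup H] [InnerProductSpace ℂ H]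
  [RKHS ℂ H G ℂ]

/-- The elements of `H` are in `L²(G, m)`, and the norm of `H` is the norm of `L²(G, m)`. -/
def IsIsometricInL2 [MeasurableSpace G] (m : Measure G) : Prop :=
  ∀ f : H, MemLp (f : G → ℂ) 2 m ∧ eLpNorm (f : G → ℂ) 2 m = ‖f‖ₑ

/-- Every `σ`-twisted left translate of an element of `H` is an element of `H`. -/
def IsTwistedInvariant (σ : G → G → Circle) : Prop :=
  ∀ (f : H) (x : G), ∃ g : H, (g : G → ℂ) = twistedTranslate σ x f

/-- `H` is contained in the Wiener amalgam space `W²(G)`: for some compact neighbourhood `Q` of the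
identity, `∫ sup_{t ∈ xQ} |f(t)|² dx < ∞` for all `f ∈ H`. -/
def IsLocalized [TopologicalSpace G] [MeasurableSpace G] (m : Measure G) : Prop :=
  ∃ Q : Set G, IsCompact Q ∧ Q ∈ 𝓝 (1 : G) ∧
    ∀ f : H, ∫⁻ x, ⨆ t ∈ x • Q, ‖f t‖ₑ ^ 2 ∂m < ∞

/-- `Λ` is a set of sampling for `H`. -/
def IsSetOfSampling (Λ : Set G) : Prop :=
  ∃ A B : ℝ, 0 < A ∧ 0 < B ∧ ∀ f : H,
    ENNReal.ofReal (A * ‖f‖ ^ 2) ≤ ∑' l : Λ, ‖f (l : G)‖ₑ ^ 2 ∧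
      ∑' l : Λ, ‖f (l : G)‖ₑ ^ 2 ≤ ENNReal.ofReal (B * ‖f‖ ^ 2)

/-- `Λ` is a set of interpolation for `H`. -/
def IsSetOfInterpolation (Λ : Set G) : Prop :=
  ∀ c : lp (fun _ : Λ => ℂ) 2, ∃ f : H, ∀ l : Λ, f (l : G) = c l

end RKHSOnGroup

end

set_option linter.unusedSectionVars false

noncomputable section

/-! ### Topology of the space of closed subsets -/

namespace ClosedSubsets

/-! For `P` in the hull let `S_P f = ∑_{λ ∈ P} f(λ) k_λ` be the frame operator. Twisted translation
by `x` conjugates `S_P` into `S_{xP}`. Take a polynomial `p` with `t p(t)² ≈ 1` on the nonzero part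
of the spectra, and put `v_P = p(S_P) k_e`, a stand-in for `S_P^{-1/2} k_e`. Then `⟨v_P, S_P v_P⟩ =
∑_{x ∈ P} |v_P(x)|²`, and covariance with self-adjointness gives `|v_P(x)| = |v_{x⁻¹P}(x⁻¹)|`. The
defining formula of the transverse measure, applied to `F(x, Q) = |v_Q(x⁻¹)|²`, together with
inversion invariance of Haar measure and the isometry into `L²`, yields `∫ ⟨v_P, S_P v_P⟩ dμ(P) = ∫
‖v_Q‖² dμ₀(Q)` (`exists_lintegral_re_inner_eq_lintegral_norm`).

Sampling: `S_P` is uniformly invertible on the hull, so the left side is about `‖k_e‖²`. On the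
right `e ∈ Q`, hence `S_Q` dominates the rank-one operator of `k_e` and `‖S_Q^{-1/2} k_e‖² ≤ 1`.
Thus `‖k_e‖² ≤ μ₀(Ω₀)`. Interpolation: `p(S_P)² S_P` is close to a projection, so the left side is
at most about `‖k_e‖²`. On the right `k_e` belongs to a Riesz sequence, `S_Q^{-1/2}` orthonormalizes
it, and the integrand is about `1`. Thus `μ₀(Ω₀) ≤ ‖k_e‖²`.

Both arguments need the bounds of `Λ` for all members of the hull. Bessel and Riesz bounds concern
finite point configurations and pass to limits by continuity of the kernel. The lower sampling bound
also needs the localization hypothesis, for uniformly small tails, and loses a factor because points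
may merge in the limit. Polynomials replace the inverse square root so that measurability and
covariance follow by induction on the degree. -/

theorem isOpen_setOf_inter_eq_empty {G : Type*} [TopologicalSpace G] {K : Set G}
    (hK : IsCompact K) : IsOpen {C : ClosedSubsets G | (C : Set G) ∩ K = ∅} :=
  TopologicalSpace.isOpen_generateFrom_of_mem (Or.inl ⟨K, hK, rfl⟩)

theorem isOpen_setOf_inter_nonempty {G : Type*} [TopologicalSpace G] {V : Set G}
    (hV : IsOpen V) : IsOpen {C : ClosedSubsets G | ((C : Set G) ∩ V).Nonempty} :=
  TopologicalSpace.isOpen_generateFrom_of_mem (Or.inr ⟨V, hV, rfl⟩)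

theorem isClosed_setOf_mem {G : Type*} [TopologicalSpace G] (x : G) :
    IsClosed {C : ClosedSubsets G | x ∈ C} := by
  rw [← isOpen_compl_iff]
  convert isOpen_setOf_inter_eq_empty (isCompact_singleton (x := x)) using 1
  ext C
  simp [SetLike.mem_coe]

/-- An ultrafilter converges to the set of points all of whose neighbourhoods are eventually hit. A
compact set missing this limit is covered by finitely many open sets that are eventually missed. -/
instance instCompactSpace (G : Type*) [TopologicalSpace G] : CompactSpace (ClosedSubsets G) := by
  refine ⟨isCompact_iff_ultrafilter_le_nhds.2 fun 𝒰 _ => ?_⟩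
  set L : Set G := {x | ∀ V : Set G, IsOpen V → x ∈ V →
    ∀ᶠ C : ClosedSubsets G in 𝒰, ((C : Set G) ∩ V).Nonempty} with hL
  have hLc : IsClosed L := by
    rw [← isOpen_compl_iff, isOpen_iff_mem_nhds]
    intro x hx
    simp only [hL, mem_compl_iff, mem_ofPred_eq, not_forall] at hx
    obtain ⟨V, hV, hxV, hn⟩ := hx
    filter_upwards [hV.mem_nhds hxV] with y hy hyL
    exact hn (hyL V hV hy)
  let C₀ : ClosedSubsets G := (⟨L, hLc⟩ : TopologicalSpace.Closeds G)
  refine ⟨C₀, mem_univ _, ?_⟩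
  change Tendsto id (𝒰 : Filter (ClosedSubsets G)) (𝓝 C₀)
  refine TopologicalSpace.tendsto_nhds_generateFrom_iff.2 ?_
  rintro O (⟨K, hK, rfl⟩ | ⟨V, hV, rfl⟩) hO
  · have hLK : L ∩ K = ∅ := hO
    have hx : ∀ x ∈ K, ∃ V : Set G, IsOpen V ∧ x ∈ V ∧
        ∀ᶠ C : ClosedSubsets G in 𝒰, (C : Set G) ∩ V = ∅ := by
      intro x hx
      have : x ∉ L := fun h => (Set.ext_iff.1 hLK x).1 ⟨h, hx⟩
      simp only [hL, mem_ofPred_eq, not_forall] at this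
      obtain ⟨V, hV, hxV, hn⟩ := this
      refine ⟨V, hV, hxV, ?_⟩
      filter_upwards [Ultrafilter.eventually_not.2 hn] with C hC
      exact Set.not_nonempty_iff_eq_empty.1 hC
    choose! V hVo hxV hV using hx
    obtain ⟨t, htK, ht⟩ := hK.elim_nhds_subcover V fun x hx => (hVo x hx).mem_nhds (hxV x hx)
    have hall : ∀ᶠ C : ClosedSubsets G in 𝒰, ∀ x ∈ t, (C : Set G) ∩ V x = ∅ :=
      (Filter.eventually_all_finset t).2 fun x hx => hV x (htK x hx)
    change ∀ᶠ C : ClosedSubsets G in 𝒰, (C : Set G) ∩ K = ∅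
    filter_upwards [hall] with C hC
    refine eq_empty_of_forall_notMem fun y hy => ?_
    obtain ⟨x, hxt, hyx⟩ := mem_iUnion₂.1 (ht hy.2)
    exact (Set.ext_iff.1 (hC x hxt) y).1 ⟨hy.1, hyx⟩
  · obtain ⟨x, hxL, hxV⟩ : (L ∩ V).Nonempty := hO
    exact hxL V hV hxV

/-- Local compactness enters for the sets that miss `K`: the translating element ranges over a
compact `N`, and `N * K` is again a compact test set. Joint continuity makes `(P, x) ↦ x⁻¹ P`
measurable. -/
theorem continuous_smul {G : Type*} [Group G] [TopologicalSpace G] [IsTopologicalGroup G]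
    [LocallyCompactSpace G] : Continuous fun p : G × ClosedSubsets G => p.1 • p.2 := by
  refine continuous_generateFrom_iff.2 ?_
  rintro O (⟨K, hK, rfl⟩ | ⟨V, hV, rfl⟩)
  · rw [isOpen_iff_mem_nhds]
    rintro ⟨x, C⟩ (h : x • (C : Set G) ∩ K = ∅)
    have hd : ∀ p ∈ ({x⁻¹} : Set G) ×ˢ K, p.1 * p.2 ∈ (C : Set G)ᶜ := by
      rintro ⟨y, z⟩ ⟨rfl : y = x⁻¹, hz⟩ hC
      refine (Set.ext_iff.1 h z).1 ⟨?_, hz⟩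
      exact Set.mem_smul_set_iff_inv_smul_mem.2 hC
    have hop : IsOpen {p : G × G | p.1 * p.2 ∈ (C : Set G)ᶜ} :=
      C.isClosed_coe.isOpen_compl.preimage continuous_mul
    obtain ⟨U, W, hU, hW, hxU, hKW, hUW⟩ :=
      generalized_tube_lemma isCompact_singleton hK hop hd
    obtain ⟨N, hN, hNU, hNc⟩ := local_compact_nhds (hU.mem_nhds (hxU rfl))
    have hx : N⁻¹ ∈ 𝓝 x := by rw [← inv_inv x, nhds_inv]; exact Filter.inv_mem_inv hN
    have hC : (C : Set G) ∩ (N * K) = ∅ := by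
      refine eq_empty_of_forall_notMem ?_
      rintro _ ⟨hc, y, hy, z, hz, rfl⟩
      exact hUW (mk_mem_prod (hNU hy) (hKW hz)) hc
    filter_upwards [prod_mem_nhds hx
      ((isOpen_setOf_inter_eq_empty (hNc.mul hK)).mem_nhds hC)]
    rintro ⟨y, D⟩ ⟨hy, hD : (D : Set G) ∩ (N * K) = ∅⟩
    refine eq_empty_of_forall_notMem (s := y • (D : Set G) ∩ K) ?_
    rintro z ⟨hz, hzK⟩
    refine (Set.ext_iff.1 hD (y⁻¹ * z)).1 ⟨?_, Set.mul_mem_mul hy hzK⟩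
    exact Set.mem_smul_set_iff_inv_smul_mem.1 hz
  · rw [isOpen_iff_mem_nhds]
    rintro ⟨x, C⟩ ⟨z, hz, hzV⟩
    obtain ⟨c, hc, rfl⟩ := hz
    have hop : IsOpen {p : G × G | p.1 * p.2 ∈ V} := hV.preimage continuous_mul
    obtain ⟨U, W, hU, hW, hxU, hcW, hUW⟩ := isOpen_prod_iff.1 hop x c hzV
    filter_upwards [prod_mem_nhds (hU.mem_nhds hxU)
      ((isOpen_setOf_inter_nonempty hW).mem_nhds ⟨c, hc, hcW⟩)]
    rintro ⟨y, D⟩ ⟨hy, d, hdD, hdW⟩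
    exact ⟨y * d, smul_mem_smul_set hdD, hUW (mk_mem_prod hy hdW)⟩

end ClosedSubsets

/-! ### Separated sets and the approximation of hull members by translates -/

section SeparatedBy

variable {G : Type*} [Group G]

/-- A point set is `(U, ℓ)`-separated if every left translate of `U` contains at most `ℓ` of its
points. -/
def IsSeparatedBy (U : Set G) (ℓ : ℕ) (P : Set G) : Prop := ∀ x : G, (P ∩ x • U).encard ≤ ℓ

theorem IsSeparatedBy.mono {U V : Set G} {ℓ : ℕ} {P : Set G} (h : IsSeparatedBy U ℓ P)
    (hVU : V ⊆ U) : IsSeparatedBy V ℓ P := fun x =>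
  (encard_le_encard (inter_subset_inter_right _ (smul_set_mono hVU))).trans (h x)

theorem IsSeparatedBy.smul {U : Set G} {ℓ : ℕ} {P : Set G} (h : IsSeparatedBy U ℓ P) (y : G) :
    IsSeparatedBy U ℓ (y • P) := fun x => by
  have : y • P ∩ x • U = y • (P ∩ (y⁻¹ * x) • U) := by
    rw [smul_set_inter, smul_smul, mul_inv_cancel_left]
  rw [this]
  have : (y • (P ∩ (y⁻¹ * x) • U)).encard = (P ∩ (y⁻¹ * x) • U).encard :=
    (MulAction.injective y).encard_image _
  rw [this]
  exact h _

end SeparatedBy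

section HullTopology

variable {G : Type*} [Group G] [TopologicalSpace G] [IsTopologicalGroup G]

/-- Members of the hull are approximated by translates of `Λ`. -/
theorem exists_translate_of_mem_hull {Λ : Set G} {P : ClosedSubsets G} (hP : P ∈ hull Λ)
    {ι : Type*} [Finite ι] {V : ι → Set G} (hV : ∀ i, IsOpen (V i))
    (hPV : ∀ i, ((P : Set G) ∩ V i).Nonempty) {K : Set G} (hK : IsCompact K)
    (hPK : (P : Set G) ∩ K = ∅) :
    ∃ x : G, (∀ i, (x • Λ ∩ V i).Nonempty) ∧ x • Λ ∩ K = ∅ := by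
  have hopen : IsOpen ((⋂ i, {C : ClosedSubsets G | ((C : Set G) ∩ V i).Nonempty}) ∩
      {C : ClosedSubsets G | (C : Set G) ∩ K = ∅}) :=
    (isOpen_iInter_of_finite fun i => ClosedSubsets.isOpen_setOf_inter_nonempty (hV i)).inter
      (ClosedSubsets.isOpen_setOf_inter_eq_empty hK)
  obtain ⟨_, ⟨hC, hCK⟩, x, rfl⟩ := mem_closure_iff.1 hP _ hopen ⟨mem_iInter.2 hPV, hPK⟩
  have hcl : ((x • ClosedSubsets.ofSet Λ : ClosedSubsets G) : Set G) = closure (x • Λ) := by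
    rw [ClosedSubsets.coe_smul, ClosedSubsets.coe_ofSet, closure_smul]
  refine ⟨x, fun i => ?_, ?_⟩
  · have := mem_iInter.1 hC i
    rw [mem_ofPred_eq, hcl] at this
    exact closure_inter_open_nonempty_iff (hV i) |>.1 this
  · rw [mem_ofPred_eq, hcl] at hCK
    exact subset_empty_iff.1 (hCK ▸ inter_subset_inter_left K subset_closure)

theorem exists_translate_inter_nonempty_of_mem_hull {Λ : Set G} {P : ClosedSubsets G}
    (hP : P ∈ hull Λ) {ι : Type*} [Finite ι] {V : ι → Set G} (hV : ∀ i, IsOpen (V i))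
    (hPV : ∀ i, ((P : Set G) ∩ V i).Nonempty) : ∃ x : G, ∀ i, (x • Λ ∩ V i).Nonempty := by
  obtain ⟨x, hx, -⟩ := exists_translate_of_mem_hull hP hV hPV isCompact_empty (by simp)
  exact ⟨x, hx⟩

instance transversal.instCompactSpace (Λ : Set G) : CompactSpace (transversal Λ) :=
  isCompact_iff_compactSpace.1
    ((isClosed_closure.inter (ClosedSubsets.isClosed_setOf_mem (1 : G))).isCompact)

instance puncturedHull.instContinuousSMul [LocallyCompactSpace G] (Λ : Set G) :
    ContinuousSMul G (puncturedHull Λ) :=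
  ⟨Continuous.subtype_mk (ClosedSubsets.continuous_smul.comp
    (continuous_fst.prodMk (continuous_subtype_val.comp continuous_snd))) _⟩

theorem IsRelativelySeparated.exists_isSeparatedBy {Λ : Set G} (h : IsRelativelySeparated Λ) :
    ∃ U : Set G, IsOpen U ∧ (1 : G) ∈ U ∧ ∃ ℓ : ℕ, IsSeparatedBy U ℓ Λ := by
  obtain ⟨U, hU, ⟨u, hu⟩, ℓ, hℓ⟩ := h
  refine ⟨u⁻¹ • U, hU.smul _, ?_, ℓ, fun x => ?_⟩
  · rw [Set.mem_inv_smul_set_iff]; simpa using hu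
  · rw [smul_smul]; exact hℓ _

/-- Finitely many points of a member of the hull are approximated by distinct points of a
translate of `Λ`. -/
theorem exists_translate_injOn_of_mem_hull [T2Space G] {Λ : Set G} {P : ClosedSubsets G}
    (hP : P ∈ hull Λ) (t : Finset G) (ht : (t : Set G) ⊆ P) {V : G → Set G}
    (hV : ∀ y ∈ t, V y ∈ 𝓝 y) :
    ∃ x : G, ∃ g : G → G, InjOn g t ∧ ∀ y ∈ t, g y ∈ x • Λ ∧ g y ∈ V y := by
  obtain ⟨W, hW, hdisj⟩ := t.finite_toSet.t2_separation
  obtain ⟨x, hx⟩ := exists_translate_inter_nonempty_of_mem_hull hP (ι := t)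
    (V := fun y => W y ∩ interior (V y)) (fun y => (hW y).2.inter isOpen_interior)
    (fun y => ⟨y, ht y.2, (hW y).1, mem_interior_iff_mem_nhds.2 (hV y y.2)⟩)
  choose g hg using hx
  classical
  refine ⟨x, fun y => if h : y ∈ t then g ⟨y, h⟩ else 1, ?_, ?_⟩
  · intro y hy z hz hyz
    simp only [Finset.mem_coe] at hy hz
    simp only [hy, hz, dite_true] at hyz
    by_contra hne
    exact (hdisj hy hz hne).le_bot ⟨(hg ⟨y, hy⟩).2.1, hyz ▸ (hg ⟨z, hz⟩).2.1⟩
  · intro y hy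
    simp only [hy, dite_true]
    exact ⟨(hg ⟨y, hy⟩).1, interior_subset (hg ⟨y, hy⟩).2.2⟩

/-- If every translate of `Λ` has at most `n` points in `V`, then so has every member of the
hull. -/
theorem encard_inter_le_of_mem_hull [T2Space G] {Λ : Set G} {V : Set G} (hV : IsOpen V) {n : ℕ}
    (h : ∀ x : G, (x • Λ ∩ V).encard ≤ n) {P : ClosedSubsets G} (hP : P ∈ hull Λ) :
    ((P : Set G) ∩ V).encard ≤ n := by
  by_contra! hlt
  obtain ⟨t, htP, ht⟩ := exists_subset_encard_eq (k := (n + 1 : ℕ)) (s := (P : Set G) ∩ V)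
    (by simpa using Order.add_one_le_of_lt hlt)
  have htf : t.Finite := finite_of_encard_eq_coe ht
  lift t to Finset G using htf
  obtain ⟨x, g, hg, hgt⟩ := exists_translate_injOn_of_mem_hull hP t
    (fun y hy => (htP hy).1) (V := fun _ => V) (fun y hy => hV.mem_nhds (htP hy).2)
  have h1 : (g '' t).encard ≤ n :=
    (encard_le_encard (by rintro _ ⟨y, hy, rfl⟩; exact hgt y hy)).trans (h x)
  rw [hg.encard_image, ht] at h1
  exact absurd (by exact_mod_cast h1) (Nat.not_succ_le_self n)

theorem IsSeparatedBy.of_mem_hull [T2Space G] {Λ : Set G} {U : Set G} (hU : IsOpen U) {ℓ : ℕ}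
    (h : IsSeparatedBy U ℓ Λ) {P : ClosedSubsets G} (hP : P ∈ hull Λ) :
    IsSeparatedBy U ℓ (P : Set G) := fun y =>
  encard_inter_le_of_mem_hull (hU.smul y) (fun x => h.smul x y) hP

end HullTopology

/-! ### The point kernel of a hull and the transverse measure -/

section PointMeasure

variable {G : Type*} [MeasurableSpace G]

/-- The counting measure on the points of `P`. -/
def pointMeasure (P : Set G) : Measure G := Measure.sum fun x : P => Measure.dirac (x : G)

theorem pointMeasure_apply {P : Set G} {B : Set G} (hB : MeasurableSet B) :
    pointMeasure P B = ((P ∩ B).encard : ℝ≥0∞) := by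
  rw [pointMeasure, Measure.sum_apply _ hB, ← ENNReal.tsum_set_one,
    tsum_subtype (P ∩ B) fun _ => (1 : ℝ≥0∞)]
  simp_rw [Measure.dirac_apply' _ hB]
  rw [tsum_subtype P fun x => B.indicator (1 : G → ℝ≥0∞) x, ← indicator_indicator]
  rfl

theorem lintegral_pointMeasure {P : Set G} {f : G → ℝ≥0∞} (hf : Measurable f) :
    ∫⁻ x, f x ∂pointMeasure P = ∑' x : P, f x := by
  simp [pointMeasure, lintegral_sum_measure, lintegral_dirac' _ hf]

end PointMeasure

section PointKernel

variable {G : Type*} [TopologicalSpace G]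

/-- Distinct points have disjoint open neighbourhoods, each of which every nearby closed set must
hit. This semicontinuity makes the point counts Borel. -/
theorem ClosedSubsets.isOpen_setOf_le_encard [T2Space G] {V : Set G} (hV : IsOpen V) (n : ℕ) :
    IsOpen {C : ClosedSubsets G | (n : ℕ∞) ≤ ((C : Set G) ∩ V).encard} := by
  rw [isOpen_iff_mem_nhds]
  intro C hC
  obtain ⟨t, htC, ht⟩ := exists_subset_encard_eq hC
  have htf : t.Finite := finite_of_encard_eq_coe ht
  obtain ⟨W, hW, hdisj⟩ := htf.t2_separation
  have : Finite t := htf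
  have hN : (⋂ y : t, {D : ClosedSubsets G | ((D : Set G) ∩ (W y ∩ V)).Nonempty}) ∈ 𝓝 C :=
    (isOpen_iInter_of_finite fun y : t =>
      ClosedSubsets.isOpen_setOf_inter_nonempty ((hW y).2.inter hV)).mem_nhds
      (mem_iInter.2 fun y => ⟨y, (htC y.2).1, (hW y).1, (htC y.2).2⟩)
  filter_upwards [hN] with D hD
  have hD' := mem_iInter.1 hD
  choose g hg using hD'
  have hinj : Function.Injective g := fun y z hyz => by
    by_contra hne
    exact (hdisj y.2 z.2 (fun h => hne (Subtype.ext h))).le_bot ⟨(hg y).2.1, hyz ▸ (hg z).2.1⟩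
  have h1 : (n : ℕ∞) = (range g).encard := by
    rw [← image_univ, hinj.encard_image, encard_univ, ← ht]; rfl
  change (n : ℕ∞) ≤ _
  rw [h1]
  refine encard_le_encard ?_
  rintro _ ⟨y, rfl⟩
  exact ⟨(hg y).1, (hg y).2.2⟩

theorem ClosedSubsets.measurable_encard_inter [T2Space G] {V : Set G} (hV : IsOpen V) :
    Measurable fun C : ClosedSubsets G => (((C : Set G) ∩ V).encard : ℝ≥0∞) := by
  refine LowerSemicontinuous.measurable fun C a ha => ?_
  change a < (((C : Set G) ∩ V).encard : ℝ≥0∞) at ha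
  obtain ⟨n, hn, han⟩ : ∃ n : ℕ, (n : ℕ∞) ≤ ((C : Set G) ∩ V).encard ∧ a < n := by
    rcases eq_or_ne ((C : Set G) ∩ V).encard ⊤ with h | h
    · rw [h] at ha
      obtain ⟨n, hn⟩ := ENNReal.exists_nat_gt (ne_of_lt ha)
      exact ⟨n, by simp [h], hn⟩
    · obtain ⟨n, hn⟩ := ENat.ne_top_iff_exists.1 h
      rw [← hn] at ha ⊢
      exact ⟨n, le_rfl, by simpa using ha⟩
  filter_upwards [(ClosedSubsets.isOpen_setOf_le_encard hV n).mem_nhds hn] with D hD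
  refine han.trans_le ?_
  have h : ((n : ℕ∞) : ℝ≥0∞) ≤ _ := ENat.toENNReal_le.2 hD
  simpa using h

variable [Group G] [IsTopologicalGroup G] [SecondCountableTopology G]
  [T2Space G] [MeasurableSpace G] [BorelSpace G]

omit [BorelSpace G] [MeasurableSpace G] [T2Space G] in
theorem exists_seq_iUnion_smul_eq_univ {U : Set G} (hU : IsOpen U) (h1 : (1 : G) ∈ U) :
    ∃ x : ℕ → G, ⋃ n, x n • U = univ := by
  obtain ⟨s, hs, hsU⟩ := TopologicalSpace.countable_cover_nhds (α := G) (f := fun x => x • U)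
    (fun x => (hU.smul x).mem_nhds ⟨1, h1, by simp⟩)
  have hne : s.Nonempty := by
    by_contra h
    rw [not_nonempty_iff_eq_empty] at h
    have : (1 : G) ∈ ⋃ x ∈ s, x • U := hsU ▸ mem_univ _
    simp [h] at this
  obtain ⟨x, rfl⟩ := hs.exists_eq_range hne
  exact ⟨x, by simpa using hsU⟩

theorem pointMeasure_le_of_mem_hull {Λ U : Set G} {ℓ : ℕ} (hU : IsOpen U)
    (h : IsSeparatedBy U ℓ Λ) {P : ClosedSubsets G} (hP : P ∈ hull Λ) (x : G) :
    pointMeasure (P : Set G) (x • U) ≤ ℓ := by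
  rw [pointMeasure_apply (hU.smul x).measurableSet]
  have h : (_ : ℝ≥0∞) ≤ ((ℓ : ℕ∞) : ℝ≥0∞) := ENat.toENNReal_le.2 ((h.of_mem_hull hU hP) x)
  simpa using h

theorem measurable_pointMeasure_restrict {Λ U : Set G} {ℓ : ℕ} (hU : IsOpen U)
    (h : IsSeparatedBy U ℓ Λ) (x : G) :
    Measurable fun P : puncturedHull Λ =>
      (pointMeasure ((P : ClosedSubsets G) : Set G)).restrict (x • U) := by
  have : ∀ P : puncturedHull Λ,
      IsFiniteMeasure ((pointMeasure ((P : ClosedSubsets G) : Set G)).restrict (x • U)) :=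
    fun P => ⟨by
      rw [Measure.restrict_apply_univ]
      exact (pointMeasure_le_of_mem_hull hU h P.2.1 x).trans_lt (ENNReal.natCast_lt_top ℓ)⟩
  have hopen : ∀ V : Set G, IsOpen V → Measurable fun P : puncturedHull Λ =>
      (pointMeasure ((P : ClosedSubsets G) : Set G)).restrict (x • U) V := by
    intro V hV
    have hVU : IsOpen (V ∩ x • U) := hV.inter (hU.smul x)
    simp_rw [Measure.restrict_apply hV.measurableSet, pointMeasure_apply hVU.measurableSet]
    exact (ClosedSubsets.measurable_encard_inter hVU).comp measurable_subtype_coe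
  exact Measurable.measure_of_isPiSystem (BorelSpace.measurable_eq (α := G)) isPiSystem_isOpen
    (fun V hV => hopen V hV) (hopen univ isOpen_univ)

open ProbabilityTheory in
/-- The kernel that maps a member of the punctured hull to the counting measure on its points. -/
theorem exists_pointKernel {Λ : Set G} (h : IsRelativelySeparated Λ) :
    ∃ κ : Kernel (puncturedHull Λ) G, IsSFiniteKernel κ ∧
      ∀ P : puncturedHull Λ, κ P = pointMeasure ((P : ClosedSubsets G) : Set G) := by
  obtain ⟨U, hU, h1, ℓ, hℓ⟩ := h.exists_isSeparatedBy
  obtain ⟨x, hx⟩ := exists_seq_iUnion_smul_eq_univ hU h1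
  -- Cutting along a disjointed countable cover by translates of `U` writes the point measures as a
  -- sum of finite kernels, as `⊗ₘ` requires an s-finite kernel.
  set D : ℕ → Set G := disjointed fun n => x n • U with hD
  have hDm : ∀ n, MeasurableSet (D n) :=
    fun n => MeasurableSet.disjointed (fun k => (hU.smul (x k)).measurableSet) n
  have hDle : ∀ n, D n ⊆ x n • U := fun n => disjointed_le _ n
  let κ : ℕ → Kernel (puncturedHull Λ) G := fun n =>
    ⟨fun P => (pointMeasure ((P : ClosedSubsets G) : Set G)).restrict (D n), by
      have := (measurable_pointMeasure_restrict hU hℓ (x n))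
      refine Measure.measurable_of_measurable_coe _ fun B hB => ?_
      convert Measure.measurable_coe (hB.inter (hDm n)) |>.comp this using 2 with P
      rw [Function.comp_apply, Measure.restrict_apply hB,
        Measure.restrict_apply (hB.inter (hDm n)),
        inter_eq_left.2 (inter_subset_right.trans (hDle n))]⟩
  have hfin : ∀ n, IsFiniteKernel (κ n) := fun n =>
    ⟨ℓ, ENNReal.natCast_lt_top ℓ, fun P => by
      change (pointMeasure ((P : ClosedSubsets G) : Set G)).restrict (D n) univ ≤ ℓ
      rw [Measure.restrict_apply_univ]
      exact (measure_mono (hDle n)).trans (pointMeasure_le_of_mem_hull hU hℓ P.2.1 (x n))⟩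
  refine ⟨Kernel.sum κ, inferInstance, fun P => ?_⟩
  ext B hB
  rw [Kernel.sum_apply, Measure.sum_apply _ hB]
  have : ∀ n, κ n P B = pointMeasure ((P : ClosedSubsets G) : Set G) (B ∩ D n) := fun n =>
    Measure.restrict_apply hB
  simp_rw [this]
  rw [← measure_iUnion, ← inter_iUnion, hD, iUnion_disjointed, hx, inter_univ]
  · exact fun i j hij => (disjoint_disjointed _ hij).mono inter_subset_right inter_subset_right
  · exact fun n => hB.inter (hDm n)

end PointKernel

section TransverseMeasure

open ProbabilityTheory

variable {G : Type*} [Group G] [TopologicalSpace G] [IsTopologicalGroup G]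
  [LocallyCompactSpace G] [SecondCountableTopology G] [T2Space G]
  [MeasurableSpace G] [BorelSpace G]

omit [MeasurableSpace G] [BorelSpace G] [LocallyCompactSpace G] [SecondCountableTopology G]
  [T2Space G] in
/-- Summing over the points of `y • P` is summing over the left translates of the points of `P`. -/
theorem tsum_smul_puncturedHull {Λ : Set G} (F : G → puncturedHull Λ → ℝ≥0∞) (y : G)
    (P : puncturedHull Λ) :
    ∑' x : (((y • P : puncturedHull Λ) : ClosedSubsets G) : Set G), F x ((x : G)⁻¹ • y • P) =
      ∑' x : ((P : ClosedSubsets G) : Set G), F (y * x) ((x : G)⁻¹ • P) := by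
  have hcoe : (((y • P : puncturedHull Λ) : ClosedSubsets G) : Set G) =
      y • ((P : ClosedSubsets G) : Set G) := rfl
  rw [hcoe]
  let e : ((P : ClosedSubsets G) : Set G) ≃ (y • ((P : ClosedSubsets G) : Set G) : Set G) :=
    Equiv.Set.image (fun x => y • x) _ (MulAction.injective y)
  rw [← e.tsum_eq]
  refine tsum_congr fun x => ?_
  change F (y * x) ((y * (x : G))⁻¹ • y • P) = _
  rw [smul_smul, mul_inv_rev, mul_assoc, inv_mul_cancel, mul_one]

/-- The measure `μ` on the punctured hull disintegrates along the orbits: there is a finite measure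
`ρ`, concentrated on the members containing the identity, that satisfies the defining formula of the
transverse measure for all measurable functions. -/
theorem exists_disintegration (m : Measure G) [m.IsHaarMeasure] {Λ : Set G}
    (h : IsRelativelySeparated Λ) (μ : Measure (puncturedHull Λ)) [IsFiniteMeasure μ]
    [SMulInvariantMeasure G (puncturedHull Λ) μ] :
    ∃ ρ : Measure (puncturedHull Λ), IsFiniteMeasure ρ ∧
      ρ {P | (1 : G) ∉ (P : ClosedSubsets G)} = 0 ∧
      ∀ F : G → puncturedHull Λ → ℝ≥0∞, Measurable (Function.uncurry F) →
        ∫⁻ P, ∑' x : ((P : ClosedSubsets G) : Set G), F x ((x : G)⁻¹ • P) ∂μ =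
          ∫⁻ Q, ∫⁻ x, F x Q ∂m ∂ρ := by
  obtain ⟨κ, hκ, hκP⟩ := exists_pointKernel h
  obtain ⟨U, hU, h1, ℓ, hℓ⟩ := h.exists_isSeparatedBy
  -- In the coordinates `(x, x⁻¹ P)` for `x ∈ P`, translating `P` moves only the first one. The
  -- image measure `ν` is therefore left-invariant in `G`, and the claim is that `ν` is a product `m
  -- × ρ`.
  set T : puncturedHull Λ × G → G × puncturedHull Λ := fun p => (p.2, p.2⁻¹ • p.1) with hT
  have hTm : Measurable T := by
    have hc : Continuous fun p : puncturedHull Λ × G => p.2⁻¹ • p.1 := by fun_prop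
    exact measurable_snd.prodMk hc.measurable
  set ν : Measure (G × puncturedHull Λ) := (μ ⊗ₘ κ).map T with hν
  have hνF : ∀ F : G → puncturedHull Λ → ℝ≥0∞, Measurable (Function.uncurry F) →
      ∫⁻ p, F p.1 p.2 ∂ν =
        ∫⁻ P, ∑' x : ((P : ClosedSubsets G) : Set G), F x ((x : G)⁻¹ • P) ∂μ := by
    intro F hF
    have hFT : Measurable fun p : puncturedHull Λ × G => F (T p).1 (T p).2 := hF.comp hTm
    have hmap := lintegral_map (μ := μ ⊗ₘ κ) hF hTm
    simp only [Function.uncurry_def] at hmap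
    rw [hν, hmap, Measure.lintegral_compProd hFT]
    refine lintegral_congr fun P => ?_
    rw [hκP]
    exact lintegral_pointMeasure (hFT.comp (measurable_prodMk_left (x := P)))
  have hinv : ∀ (F : G → puncturedHull Λ → ℝ≥0∞) (y : G), Measurable (Function.uncurry F) →
      ∫⁻ p, F (y * p.1) p.2 ∂ν = ∫⁻ p, F p.1 p.2 ∂ν := by
    intro F y hF
    have hFy : Measurable (Function.uncurry fun x Q => F (y * x) Q) :=
      hF.comp ((measurable_const_mul y).prodMap measurable_id)
    rw [hνF F hF, hνF (fun x Q => F (y * x) Q) hFy]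
    simp_rw [← tsum_smul_puncturedHull F y]
    exact (measurePreserving_smul y μ).lintegral_comp_emb
      (MeasurableEquiv.smul y).measurableEmbedding (fun P : puncturedHull Λ =>
        ∑' x : ((P : ClosedSubsets G) : Set G), F x ((x : G)⁻¹ • P))
  have hνrect : ∀ (B : Set G) (E : Set (puncturedHull Λ)), MeasurableSet B → MeasurableSet E →
      ν (B ×ˢ E) = ∫⁻ p, B.indicator 1 p.1 * E.indicator 1 p.2 ∂ν := by
    intro B E hB hE
    rw [← lintegral_indicator_one (hB.prod hE)]
    refine lintegral_congr fun p => ?_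
    by_cases h1 : p.1 ∈ B <;> by_cases h2 : p.2 ∈ E <;> simp [indicator, h1, h2]
  have hmrect : ∀ (B : Set G) (E : Set (puncturedHull Λ)), MeasurableSet B → MeasurableSet E →
      Measurable (Function.uncurry fun x Q =>
        (B.indicator 1 x * E.indicator 1 Q : ℝ≥0∞)) := fun B E hB hE =>
    ((measurable_one.indicator hB).comp measurable_fst).mul
      ((measurable_one.indicator hE).comp measurable_snd)
  have hνU : ∀ x : G, ν ((x • U) ×ˢ univ) < ∞ := by
    intro x
    have hUm := (hU.smul x).measurableSet
    rw [hνrect _ _ hUm MeasurableSet.univ, hνF _ (hmrect _ _ hUm MeasurableSet.univ)]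
    calc _ ≤ ∫⁻ _, (ℓ : ℝ≥0∞) ∂μ := by
          refine lintegral_mono fun P => ?_
          simp only [indicator_univ, Pi.one_apply, mul_one]
          rw [← lintegral_pointMeasure (measurable_one.indicator hUm),
            lintegral_indicator_one hUm]
          exact pointMeasure_le_of_mem_hull hU hℓ P.2.1 x
      _ < ∞ := by
          rw [lintegral_const]
          exact ENNReal.mul_lt_top (ENNReal.natCast_lt_top ℓ) (measure_lt_top μ _)
  have hνK : ∀ K : Set G, IsCompact K → ν (K ×ˢ univ) < ∞ := by
    intro K hK
    obtain ⟨t, -, ht⟩ := hK.elim_nhds_subcover (fun x => x • U)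
      fun x _ => (hU.smul x).mem_nhds ⟨1, h1, by simp⟩
    calc ν (K ×ˢ univ) ≤ ν (⋃ x ∈ t, (x • U) ×ˢ univ) := measure_mono (by
          rintro ⟨y, Q⟩ ⟨hy, -⟩
          simpa using ht hy)
      _ ≤ ∑ x ∈ t, ν ((x • U) ×ˢ univ) := measure_biUnion_finset_le _ _
      _ < ∞ := ENNReal.sum_lt_top.2 fun x _ => hνU x
  obtain ⟨W, hW, hW1⟩ := exists_compact_mem_nhds (1 : G)
  have hWm : MeasurableSet W := hW.measurableSet
  have hmW0 : m W ≠ 0 := (Measure.measure_pos_of_mem_nhds m hW1).ne'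
  have hmWt : m W ≠ ∞ := hW.measure_ne_top
  set ρ : Measure (puncturedHull Λ) := (m W)⁻¹ • (ν.restrict (W ×ˢ univ)).map Prod.snd with hρ
  have hρE : ∀ E, MeasurableSet E → ρ E = (m W)⁻¹ * ν (W ×ˢ E) := by
    intro E hE
    rw [hρ, Measure.smul_apply, smul_eq_mul, Measure.map_apply measurable_snd hE,
      Measure.restrict_apply (measurable_snd hE)]
    congr 2
    ext ⟨x, Q⟩
    simp [and_comm]
  have hρfin : IsFiniteMeasure ρ := ⟨by
    rw [hρE _ MeasurableSet.univ]
    exact ENNReal.mul_lt_top (ENNReal.inv_lt_top.2 (pos_iff_ne_zero.2 hmW0)) (hνK W hW)⟩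
  have hprod : m.prod ρ = ν := by
    refine Measure.prod_eq fun B E hB hE => ?_
    -- For fixed `E`, `B ↦ ν (B × E)` is left-invariant and finite on compact sets, hence a multiple
    -- of `m`. Evaluation at `W` identifies the factor as `ρ E`.
    set νE : Measure G := (ν.restrict (univ ×ˢ E)).map Prod.fst with hνE
    have hνEB : ∀ B, MeasurableSet B → νE B = ν (B ×ˢ E) := by
      intro B hB
      rw [hνE, Measure.map_apply measurable_fst hB, Measure.restrict_apply (measurable_fst hB)]
      congr 1
      ext ⟨x, Q⟩
      simp
    have hleft : νE.IsMulLeftInvariant := by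
      refine ⟨fun y => Measure.ext fun B hB => ?_⟩
      have hyB : MeasurableSet ((y * ·) ⁻¹' B) := measurable_const_mul y hB
      rw [Measure.map_apply (measurable_const_mul y) hB, hνEB _ hyB, hνEB _ hB,
        hνrect _ _ hyB hE, hνrect _ _ hB hE, ← hinv _ y (hmrect B E hB hE)]
      rfl
    have hcomp : IsFiniteMeasureOnCompacts νE := ⟨fun K hK => by
      rw [hνEB _ hK.measurableSet]
      exact (measure_mono (prod_mono_right (subset_univ E))).trans_lt (hνK K hK)⟩
    have hsmul := Measure.isMulLeftInvariant_eq_smul νE m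
    set c := Measure.haarScalarFactor νE m
    have hc : ∀ B, MeasurableSet B → ν (B ×ˢ E) = c * m B := fun B hB => by
      rw [← hνEB B hB, hsmul]; rfl
    rw [hρE E hE, hc B hB, hc W hWm]
    calc (c : ℝ≥0∞) * m B = c * m B * ((m W)⁻¹ * m W) := by
          rw [ENNReal.inv_mul_cancel hmW0 hmWt, mul_one]
      _ = m B * ((m W)⁻¹ * (c * m W)) := by ring
  have hmain : ∀ F : G → puncturedHull Λ → ℝ≥0∞, Measurable (Function.uncurry F) →
        ∫⁻ P, ∑' x : ((P : ClosedSubsets G) : Set G), F x ((x : G)⁻¹ • P) ∂μ =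
          ∫⁻ Q, ∫⁻ x, F x Q ∂m ∂ρ := by
    intro F hF
    rw [← hνF F hF, ← hprod]
    exact lintegral_prod_symm' (Function.uncurry F) hF
  refine ⟨ρ, hρfin, ?_, hmain⟩
  have hE : MeasurableSet {P : puncturedHull Λ | (1 : G) ∉ (P : ClosedSubsets G)} :=
    ((ClosedSubsets.isClosed_setOf_mem (1 : G)).preimage
      continuous_subtype_val).isOpen_compl.measurableSet
  rw [hρE _ hE, hνrect _ _ hWm hE, hνF _ (hmrect _ _ hWm hE)]
  refine mul_eq_zero_of_right _ ?_
  rw [lintegral_eq_zero_of_ae_eq_zero]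
  refine Eventually.of_forall fun P => ENNReal.tsum_eq_zero.2 fun x => ?_
  refine mul_eq_zero_of_right _ (indicator_of_notMem ?_ _)
  simp only [mem_ofPred_eq, not_not]
  -- Only `x ∈ P` contribute to `ν`, and then `x⁻¹ P` contains the identity.
  exact (puncturedHull.toTransversal P x).2.2

/-- The inclusion of the transversal into the punctured hull. -/
def transversal.toPuncturedHull {Λ : Set G} (Q : transversal Λ) : puncturedHull Λ :=
  ⟨Q, Q.2.1, 1, Q.2.2⟩

theorem transversal.isClosedEmbedding_toPuncturedHull (Λ : Set G) :
    IsClosedEmbedding (transversal.toPuncturedHull (Λ := Λ)) := by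
  refine ⟨Topology.IsEmbedding.of_comp (continuous_subtype_val.subtype_mk _)
    continuous_subtype_val Topology.IsEmbedding.subtypeVal, ?_⟩
  convert (ClosedSubsets.isClosed_setOf_mem (1 : G)).preimage
    (continuous_subtype_val (p := fun P => P ∈ puncturedHull Λ)) using 1
  ext P
  exact ⟨by rintro ⟨Q, rfl⟩; exact Q.2.2, fun hP => ⟨⟨P, P.2.1, hP⟩, rfl⟩⟩

/-- The disintegration formula, together with the total mass of the transverse measure. -/
theorem exists_disintegration_transverseMeasure (m : Measure G) [m.IsHaarMeasure] {Λ : Set G}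
    (h : IsRelativelySeparated Λ) (μ : Measure (puncturedHull Λ)) [IsFiniteMeasure μ]
    [SMulInvariantMeasure G (puncturedHull Λ) μ] :
    ∃ ρ : Measure (puncturedHull Λ), IsFiniteMeasure ρ ∧
      ρ {P | (1 : G) ∉ (P : ClosedSubsets G)} = 0 ∧
      transverseMeasure m Λ μ univ = ρ univ ∧
      ∀ F : G → puncturedHull Λ → ℝ≥0∞, Measurable (Function.uncurry F) →
        ∫⁻ P, ∑' x : ((P : ClosedSubsets G) : Set G), F x ((x : G)⁻¹ • P) ∂μ =
          ∫⁻ Q, ∫⁻ x, F x Q ∂m ∂ρ := by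
  obtain ⟨ρ, hρfin, hρ1, hρ⟩ := exists_disintegration m h μ
  refine ⟨ρ, hρfin, hρ1, ?_, hρ⟩
  set j := transversal.toPuncturedHull (Λ := Λ) with hj
  have hjm : MeasurableEmbedding j :=
    (transversal.isClosedEmbedding_toPuncturedHull Λ).measurableEmbedding
  have hrange : ∀ᵐ P ∂ρ, P ∈ range j := by
    refine measure_mono_null (fun P hP => ?_) hρ1
    intro h1
    exact hP ⟨⟨P, P.2.1, h1⟩, rfl⟩
  have hmap : (ρ.comap j).map j = ρ := by
    rw [hjm.map_comap, Measure.restrict_eq_self_of_ae_mem hrange]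
  have htrans : IsTransverseMeasure m Λ μ (ρ.comap j) := by
    intro F
    set F' : G → puncturedHull Λ → ℝ≥0∞ :=
      fun x P => Function.extend (Prod.map id j) (fun p => (F p : ℝ≥0∞)) 0 (x, P) with hF'
    have hemb : MeasurableEmbedding (Prod.map (id : G → G) j) := MeasurableEmbedding.id.prodMap hjm
    have hFm : Measurable fun p => (F p : ℝ≥0∞) :=
      (ENNReal.continuous_coe.comp F.continuous).measurable
    have hF'm : Measurable (Function.uncurry F') := hemb.measurable_extend hFm measurable_const
    have hF'j : ∀ x Q, F' x (j Q) = F (x, Q) := fun x Q =>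
      hemb.injective.extend_apply _ _ (x, Q)
    calc ∫⁻ P, ∑' x : (P : ClosedSubsets G),
          (F ((x : G), puncturedHull.toTransversal P x) : ℝ≥0∞) ∂μ
        = ∫⁻ P, ∑' x : ((P : ClosedSubsets G) : Set G), F' x ((x : G)⁻¹ • P) ∂μ := by
          refine lintegral_congr fun P => tsum_congr fun x => ?_
          rw [← hF'j]
          rfl
      _ = ∫⁻ P, ∫⁻ x, F' x P ∂m ∂(ρ.comap j).map j := by rw [hρ F' hF'm, hmap]
      _ = ∫⁻ Q, ∫⁻ x, F' x (j Q) ∂m ∂ρ.comap j := hjm.lintegral_map _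
      _ = ∫⁻ Q, ∫⁻ x, (F (x, Q) : ℝ≥0∞) ∂m ∂ρ.comap j := by simp_rw [hF'j]
  have hex : ∃ μ₀, IsTransverseMeasure m Λ μ μ₀ := ⟨_, htrans⟩
  have hT : IsTransverseMeasure m Λ μ (transverseMeasure m Λ μ) := by
    rw [transverseMeasure, dif_pos hex]
    exact hex.choose_spec
  obtain ⟨φ, hφ1, hφle⟩ : ∃ φ : C_c(G, ℝ≥0), φ 1 = 1 ∧ ∀ x, φ x ≤ 1 := by
    obtain ⟨f, hf1, -, hfc, hf01⟩ := exists_continuous_one_zero_of_isCompact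
      (isCompact_singleton (x := (1 : G))) isClosed_empty (disjoint_empty _)
    refine ⟨⟨⟨fun x => (f x).toNNReal, by fun_prop⟩,
      hfc.comp_left (g := Real.toNNReal) Real.toNNReal_zero⟩, ?_, fun x => ?_⟩
    · change (f 1).toNNReal = 1
      rw [hf1 rfl]
      simp
    · exact Real.toNNReal_le_one.2 (hf01 x).2
  -- A test function that does not depend on `Q` is admissible since the transversal is compact. It
  -- fixes the total mass of every transverse measure, so the choice made in `transverseMeasure` is
  -- immaterial.
  let F : C_c(G × transversal Λ, ℝ≥0) :=
    ⟨⟨fun p => φ p.1, by fun_prop⟩, by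
      refine (φ.hasCompactSupport.isCompact.prod isCompact_univ).of_isClosed_subset
        (isClosed_tsupport _) (closure_minimal (fun p hp => ⟨?_, mem_univ _⟩)
          ((isClosed_tsupport _).prod isClosed_univ))
      exact subset_tsupport _ hp⟩
  have hmass : ∀ μ₀, IsTransverseMeasure m Λ μ μ₀ →
      ∫⁻ P, ∑' x : (P : ClosedSubsets G), (φ (x : G) : ℝ≥0∞) ∂μ =
        (∫⁻ x, (φ x : ℝ≥0∞) ∂m) * μ₀ univ := by
    intro μ₀ h₀
    rw [← lintegral_const]
    exact h₀ F
  have hφm : Measurable fun x => (φ x : ℝ≥0∞) :=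
    (ENNReal.continuous_coe.comp φ.continuous).measurable
  have hφpos : ∫⁻ x, (φ x : ℝ≥0∞) ∂m ≠ 0 := by
    refine ((lintegral_pos_iff_support hφm).2 ?_).ne'
    have hopen : IsOpen (Function.support fun x => (φ x : ℝ≥0∞)) :=
      (ENNReal.continuous_coe.comp φ.continuous).isOpen_support
    exact hopen.measure_pos m ⟨1, by simp [hφ1]⟩
  have hφfin : ∫⁻ x, (φ x : ℝ≥0∞) ∂m ≠ ∞ := by
    refine ne_of_lt (lt_of_le_of_lt (b := ∫⁻ x, (tsupport φ).indicator 1 x ∂m)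
      (lintegral_mono fun x => ?_) ?_)
    · by_cases hx : x ∈ tsupport φ
      · simpa [hx] using hφle x
      · simp [image_eq_zero_of_notMem_tsupport hx]
    · rw [lintegral_indicator_one (isClosed_tsupport _).measurableSet]
      exact φ.hasCompactSupport.isCompact.measure_lt_top
  have hcomap : ρ.comap j univ = ρ univ := by
    conv_rhs => rw [← hmap, hjm.map_apply, preimage_univ]
  rw [← hcomap]
  exact (ENNReal.mul_right_inj hφpos hφfin).1 ((hmass _ hT).symm.trans (hmass _ htrans))

end TransverseMeasure

/-! ### Twisted translations on a reproducing kernel Hilbert space -/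

section Cocycle

variable {G : Type*} [Group G] [TopologicalSpace G] {σ : G → G → Circle}

theorem IsContinuousTwoCocycle.one_left (hσ : IsContinuousTwoCocycle σ) (y : G) : σ 1 y = 1 := by
  have h := hσ.cocycle 1 1 y
  rw [hσ.map_one_one, one_mul, one_mul, one_mul] at h
  exact mul_eq_left.1 h.symm

theorem IsContinuousTwoCocycle.one_right (hσ : IsContinuousTwoCocycle σ) (x : G) : σ x 1 = 1 := by
  have h := hσ.cocycle x 1 1
  rw [hσ.map_one_one, mul_one, mul_one, mul_one] at h
  exact mul_eq_left.1 h

theorem IsContinuousTwoCocycle.comp_inv (hσ : IsContinuousTwoCocycle σ) (x y : G) :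
    σ x (x⁻¹ * y) * σ x⁻¹ y = σ x x⁻¹ := by
  have h := hσ.cocycle x x⁻¹ y
  rw [mul_inv_cancel, hσ.one_left, mul_one] at h
  exact h.symm

end Cocycle

section KernelVector

variable {G : Type*} (H : Type*) [NormedAddCommGroup H] [InnerProductSpace ℂ H] [CompleteSpace H]
  [RKHS ℂ H G ℂ]

/-- The vector `k_x` that represents the evaluation at `x`. -/
abbrev kernelVector (x : G) : H := RKHS.kerFun H x (1 : ℂ)

variable {H}

theorem inner_kernelVector_left (x : G) (f : H) : inner ℂ (kernelVector H x) f = f x := by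
  rw [kernelVector, RKHS.kerFun_inner]; simp

end KernelVector

section TwistedShift

variable {G : Type*} [Group G] [TopologicalSpace G] [IsTopologicalGroup G]
  [LocallyCompactSpace G] [SecondCountableTopology G] [T2Space G]
  [MeasurableSpace G] [BorelSpace G]
  {m : Measure G} [m.IsHaarMeasure] {σ : G → G → Circle}
  {H : Type*} [NormedAddCommGroup H] [InnerProductSpace ℂ H] [RKHS ℂ H G ℂ]

theorem continuous_coe_circle : Continuous fun z : Circle => (z : ℂ) := continuous_induced_dom

theorem enorm_coe_circle (z : Circle) : ‖(z : ℂ)‖ₑ = 1 := by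
  rw [← ofReal_norm, Circle.norm_coe, ENNReal.ofReal_one]

theorem enorm_twistedTranslate (x : G) (f : G → ℂ) (y : G) :
    ‖twistedTranslate σ x f y‖ₑ = ‖f (x⁻¹ * y)‖ₑ := by
  rw [twistedTranslate, enorm_mul, enorm_coe_circle, one_mul]

theorem eLpNorm_twistedTranslate (x : G) {f : G → ℂ} (hf : AEStronglyMeasurable f m) :
    eLpNorm (twistedTranslate σ x f) 2 m = eLpNorm f 2 m := by
  rw [← eLpNorm_comp_measurePreserving hf (measurePreserving_mul_left m x⁻¹)]
  exact eLpNorm_congr_enorm_ae (Eventually.of_forall fun y => enorm_twistedTranslate x f y)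

/-- The twisted translation by `x` on `H`, as a linear map. -/
def twistedShiftLinear (hinv : IsTwistedInvariant H σ) (x : G) : H →ₗ[ℂ] H where
  toFun f := (hinv f x).choose
  map_add' f g := DFunLike.coe_injective (F := H) <| by
    refine (hinv _ x).choose_spec.trans ?_
    rw [RKHS.coe_add, RKHS.coe_add, (hinv f x).choose_spec, (hinv g x).choose_spec]
    ext y; simp [twistedTranslate, mul_add]
  map_smul' c f := DFunLike.coe_injective (F := H) <| by
    refine (hinv _ x).choose_spec.trans ?_
    rw [RingHom.id_apply, RKHS.coe_smul, RKHS.coe_smul, (hinv f x).choose_spec]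
    ext y; simp [twistedTranslate, mul_left_comm]

theorem coe_twistedShiftLinear (hinv : IsTwistedInvariant H σ) (x : G) (f : H) :
    (twistedShiftLinear hinv x f : G → ℂ) = twistedTranslate σ x f :=
  (hinv f x).choose_spec

theorem twistedShiftLinear_surjective (hσ : IsContinuousTwoCocycle σ)
    (hinv : IsTwistedInvariant H σ) (x : G) : Function.Surjective (twistedShiftLinear hinv x) := by
  intro f
  -- Translating by `x⁻¹` and then by `x` multiplies by the constant phase `σ x x⁻¹`, which is
  -- divided out in advance.
  refine ⟨twistedShiftLinear hinv x⁻¹ (((σ x x⁻¹)⁻¹ : Circle) • f : H),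
    DFunLike.coe_injective (F := H) ?_⟩
  rw [coe_twistedShiftLinear]
  ext y
  rw [twistedTranslate, coe_twistedShiftLinear, twistedTranslate, Circle.smul_def, RKHS.coe_smul,
    Pi.smul_apply, smul_eq_mul, inv_inv, mul_inv_cancel_left, ← mul_assoc, ← mul_assoc,
    ← Circle.coe_mul, hσ.comp_inv, ← Circle.coe_mul, mul_inv_cancel, Circle.coe_one, one_mul]

/-- The twisted translation by `x` on `H`, as a unitary operator. -/
def twistedShift (hσ : IsContinuousTwoCocycle σ) (hL2 : IsIsometricInL2 H m)
    (hinv : IsTwistedInvariant H σ) (x : G) : H ≃ₗᵢ[ℂ] H :=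
  LinearIsometryEquiv.ofSurjective
    ⟨twistedShiftLinear hinv x, fun f => by
      have h : ‖twistedShiftLinear hinv x f‖ₑ = ‖f‖ₑ := by
        rw [← (hL2 _).2, coe_twistedShiftLinear, eLpNorm_twistedTranslate x (hL2 f).1.1, (hL2 f).2]
      simpa [enorm_eq_nnnorm, ← NNReal.coe_inj] using h⟩
    (twistedShiftLinear_surjective hσ hinv x)

variable (hσ : IsContinuousTwoCocycle σ) (hL2 : IsIsometricInL2 H m)
  (hinv : IsTwistedInvariant H σ)

theorem coe_twistedShift (x : G) (f : H) :
    (twistedShift hσ hL2 hinv x f : G → ℂ) = twistedTranslate σ x f :=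
  coe_twistedShiftLinear hinv x f

theorem twistedShift_apply (x : G) (f : H) (y : G) :
    twistedShift hσ hL2 hinv x f y = σ x (x⁻¹ * y) * f (x⁻¹ * y) := by
  rw [coe_twistedShift, twistedTranslate]

theorem norm_twistedShift_apply (x : G) (f : H) (y : G) :
    ‖twistedShift hσ hL2 hinv x f y‖ = ‖f (x⁻¹ * y)‖ := by
  rw [twistedShift_apply, norm_mul, Circle.norm_coe, one_mul]

theorem tendsto_eLpNorm_translate_sub {f : G → ℂ} (hf : MemLp f 2 m) (x₀ : G) :
    Tendsto (fun x : G => eLpNorm (fun y => f (x⁻¹ * y) - f (x₀⁻¹ * y)) 2 m) (𝓝 x₀) (𝓝 0) := by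
  have : Fact ((2 : ℝ≥0∞) ≠ ∞) := ⟨ENNReal.ofNat_ne_top⟩
  have hc : Continuous fun x : G => DomMulAct.mk x⁻¹ • hf.toLp f :=
    (DomMulAct.continuous_mk.comp continuous_inv).smul continuous_const
  have h := (tendsto_iff_edist_tendsto_0.1 (hc.tendsto x₀))
  convert h using 2 with x
  rw [DomMulAct.mk_smul_toLp, DomMulAct.mk_smul_toLp, Lp.edist_toLp_toLp]
  rfl

/-- Dominated convergence: two phases differ by at most `2`, so the squared integrand is at most `4
|f(x₀⁻¹ y)|²`. -/
theorem tendsto_eLpNorm_cocycle_sub (hσ : IsContinuousTwoCocycle σ) {f : G → ℂ} (hf : MemLp f 2 m)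
    (x₀ : G) :
    Tendsto (fun x : G => eLpNorm (fun y =>
      ((σ x (x⁻¹ * y) : ℂ) - (σ x₀ (x₀⁻¹ * y) : ℂ)) * f (x₀⁻¹ * y)) 2 m) (𝓝 x₀) (𝓝 0) := by
  have hσc : Continuous fun p : G × G => (σ p.1 (p.1⁻¹ * p.2) : ℂ) := by
    have := hσ.continuous
    exact continuous_coe_circle.comp (this.comp
      (continuous_fst.prodMk (continuous_fst.inv.mul continuous_snd)))
  have hf₀ : MemLp (fun y => f (x₀⁻¹ * y)) 2 m :=
    hf.comp_measurePreserving (measurePreserving_mul_left m x₀⁻¹)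
  have hm : ∀ x, AEStronglyMeasurable (fun y =>
      ((σ x (x⁻¹ * y) : ℂ) - (σ x₀ (x₀⁻¹ * y) : ℂ)) * f (x₀⁻¹ * y)) m := fun x =>
    (((hσc.comp (Continuous.prodMk_right x)).sub
      (hσc.comp (Continuous.prodMk_right x₀))).aestronglyMeasurable).mul hf₀.1
  have hlim : Tendsto (fun x : G => ∫⁻ y, ‖((σ x (x⁻¹ * y) : ℂ) - (σ x₀ (x₀⁻¹ * y) : ℂ)) *
      f (x₀⁻¹ * y)‖ₑ ^ (2 : ℝ) ∂m) (𝓝 x₀) (𝓝 (∫⁻ _, 0 ∂m)) := by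
    refine tendsto_lintegral_filter_of_dominated_convergence'
      (fun y => 4 * ‖f (x₀⁻¹ * y)‖ₑ ^ (2 : ℝ)) (Eventually.of_forall fun x =>
        (hm x).enorm.pow_const _) (Eventually.of_forall fun x => Eventually.of_forall fun y => ?_)
      ?_ (Eventually.of_forall fun y => ?_)
    · rw [enorm_mul, ENNReal.mul_rpow_of_nonneg _ _ zero_le_two]
      gcongr
      have h2 : ‖(σ x (x⁻¹ * y) : ℂ) - (σ x₀ (x₀⁻¹ * y) : ℂ)‖ₑ ≤ 2 := by
        refine (enorm_sub_le).trans ?_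
        rw [enorm_coe_circle, enorm_coe_circle]
        norm_num
      calc _ ≤ (2 : ℝ≥0∞) ^ (2 : ℝ) := by gcongr
        _ = 4 := by norm_num
    · rw [lintegral_const_mul' _ _ (by norm_num)]
      refine ENNReal.mul_ne_top (by norm_num) (ne_of_lt ?_)
      have := lintegral_rpow_enorm_lt_top_of_eLpNorm_lt_top two_ne_zero ENNReal.ofNat_ne_top hf₀.2
      simpa using this
    · have hcont : Continuous fun x : G => ‖((σ x (x⁻¹ * y) : ℂ) - (σ x₀ (x₀⁻¹ * y) : ℂ)) *
          f (x₀⁻¹ * y)‖ₑ ^ (2 : ℝ) := by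
        refine (ENNReal.continuous_rpow_const).comp (continuous_enorm.comp ?_)
        exact ((hσc.comp (Continuous.prodMk_left y)).sub continuous_const).mul continuous_const
      have := hcont.tendsto x₀
      simpa using this
  have h2 := (ENNReal.continuous_rpow_const (y := (1 / 2 : ℝ))).continuousAt.tendsto.comp hlim
  simp only [lintegral_zero] at h2
  rw [ENNReal.zero_rpow_of_pos (by norm_num)] at h2
  convert h2 using 2 with x
  rw [eLpNorm_eq_lintegral_rpow_enorm_toReal two_ne_zero ENNReal.ofNat_ne_top]
  simp

/-- The difference splits into a phase times a difference of ordinary translates and a difference of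
phases times a fixed translate. Applied to `k_e`, this gives norm continuity of `x ↦ k_x`, hence
continuity of every element of `H`. -/
theorem continuous_twistedShift (f : H) : Continuous fun x => twistedShift hσ hL2 hinv x f := by
  refine continuous_iff_continuousAt.2 fun x₀ => ?_
  refine tendsto_iff_edist_tendsto_0.2 ?_
  have hsum := (tendsto_eLpNorm_translate_sub (hL2 f).1 x₀).add
    (tendsto_eLpNorm_cocycle_sub hσ (hL2 f).1 x₀)
  rw [add_zero] at hsum
  refine tendsto_of_tendsto_of_tendsto_of_le_of_le tendsto_const_nhds hsum (fun _ => zero_le) ?_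
  intro x
  have hσx : Continuous fun y => (σ x (x⁻¹ * y) : ℂ) :=
    continuous_coe_circle.comp (hσ.continuous.comp
      (continuous_const.prodMk (continuous_const.mul continuous_id)))
  have hσx₀ : Continuous fun y => (σ x₀ (x₀⁻¹ * y) : ℂ) :=
    continuous_coe_circle.comp (hσ.continuous.comp
      (continuous_const.prodMk (continuous_const.mul continuous_id)))
  have hf : ∀ z : G, AEStronglyMeasurable (fun y => f (z * y)) m := fun z =>
    ((hL2 f).1.comp_measurePreserving (measurePreserving_mul_left m z)).1
  change edist (twistedShift hσ hL2 hinv x f) (twistedShift hσ hL2 hinv x₀ f) ≤ _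
  rw [edist_eq_enorm_sub, ← (hL2 _).2]
  have heq : ((twistedShift hσ hL2 hinv x f - twistedShift hσ hL2 hinv x₀ f : H) : G → ℂ) =
      (fun y => (σ x (x⁻¹ * y) : ℂ) * (f (x⁻¹ * y) - f (x₀⁻¹ * y))) +
      fun y => ((σ x (x⁻¹ * y) : ℂ) - (σ x₀ (x₀⁻¹ * y) : ℂ)) * f (x₀⁻¹ * y) := by
    ext y
    rw [RKHS.coe_sub, Pi.sub_apply, twistedShift_apply, twistedShift_apply, Pi.add_apply]
    ring
  rw [heq]
  refine (eLpNorm_add_le (hσx.aestronglyMeasurable.mul ((hf _).sub (hf _)))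
    ((hσx.aestronglyMeasurable.sub hσx₀.aestronglyMeasurable).mul (hf _)) one_le_two).trans ?_
  refine add_le_add (eLpNorm_congr_enorm_ae (Eventually.of_forall fun y => ?_)).le le_rfl
  change ‖(σ x (x⁻¹ * y) : ℂ) * (f (x⁻¹ * y) - f (x₀⁻¹ * y))‖ₑ = _
  rw [enorm_mul, enorm_coe_circle, one_mul]

variable [CompleteSpace H]

theorem twistedShift_kernelVector_one (x : G) :
    twistedShift hσ hL2 hinv x (kernelVector H 1) = kernelVector H x := by
  refine ext_inner_right ℂ fun f => ?_
  obtain ⟨g, rfl⟩ := (twistedShift hσ hL2 hinv x).surjective f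
  rw [LinearIsometryEquiv.inner_map_map, inner_kernelVector_left, inner_kernelVector_left,
    twistedShift_apply, inv_mul_cancel, hσ.one_right, Circle.coe_one, one_mul]

/-- Twisted translates of kernel vectors are kernel vectors, up to a phase. -/
theorem twistedShift_kernelVector (x y : G) :
    ((σ x y)⁻¹ : Circle) • twistedShift hσ hL2 hinv x (kernelVector H y) = kernelVector H (x * y) := by
  refine ext_inner_right ℂ fun f => ?_
  obtain ⟨g, rfl⟩ := (twistedShift hσ hL2 hinv x).surjective f
  rw [Circle.smul_def, inner_smul_left, LinearIsometryEquiv.inner_map_map,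
    inner_kernelVector_left, inner_kernelVector_left, twistedShift_apply, inv_mul_cancel_left,
    ← Circle.coe_inv_eq_conj, inv_inv]

include hσ hL2 hinv in
theorem norm_kernelVector (x : G) : ‖kernelVector H x‖ = ‖kernelVector H (1 : G)‖ := by
  rw [← twistedShift_kernelVector_one hσ hL2 hinv x, LinearIsometryEquiv.norm_map]

include hσ hL2 hinv in
theorem continuous_kernelVector : Continuous fun x : G => kernelVector H x := by
  have h := continuous_twistedShift hσ hL2 hinv (kernelVector H 1)
  rwa [funext fun x => twistedShift_kernelVector_one hσ hL2 hinv x] at h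

include hσ hL2 hinv in
theorem continuous_coe (f : H) : Continuous (f : G → ℂ) := by
  have h : Continuous fun x : G => inner ℂ (kernelVector H x) f :=
    (continuous_kernelVector hσ hL2 hinv).inner continuous_const
  rwa [funext fun x => inner_kernelVector_left x f] at h

include hσ hL2 hinv in
theorem kernelVector_one_ne_zero [Nontrivial H] : kernelVector H (1 : G) ≠ 0 := by
  intro h
  obtain ⟨f, hf⟩ := exists_ne (0 : H)
  refine hf (DFunLike.coe_injective (F := H) (funext fun x => ?_))
  have hx : kernelVector H x = 0 := by
    rw [← norm_eq_zero, norm_kernelVector hσ hL2 hinv, h, norm_zero]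
  rw [← inner_kernelVector_left, hx, inner_zero_left, RKHS.coe_zero, Pi.zero_apply]

end TwistedShift

/-! ### Sampling and Riesz bounds on the hull -/

section Configurations

variable {G : Type*} [Group G] [TopologicalSpace G] [IsTopologicalGroup G] [T2Space G]

/-- An open condition on the positions of finitely many points of a member of the hull is satisfied
by distinct points of a translate of `Λ`. -/
theorem exists_translate_configuration {Λ : Set G} {P : ClosedSubsets G}
    (hP : P ∈ hull Λ) (t : Finset G) (ht : (t : Set G) ⊆ P) {s : Set (G → G)} (hs : s ∈ 𝓝 id) :
    ∃ x : G, ∃ g ∈ s, InjOn g t ∧ ∀ y ∈ t, g y ∈ x • Λ := by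
  classical
  rw [nhds_pi, Filter.mem_pi] at hs
  obtain ⟨I, -, V, hV, hVs⟩ := hs
  obtain ⟨x, g, hg, hgt⟩ := exists_translate_injOn_of_mem_hull hP t ht fun y _ => hV y
  refine ⟨x, fun y => if y ∈ t then g y else y, hVs fun y _ => ?_, ?_, ?_⟩
  · by_cases hy : y ∈ t
    · simpa [hy] using (hgt y hy).2
    · simpa [hy] using mem_of_mem_nhds (hV y)
  · intro y hy z hz hyz
    rw [Finset.mem_coe] at hy hz
    exact hg hy hz (by simpa [hy, hz] using hyz)
  · intro y hy
    simpa [hy] using (hgt y hy).1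

end Configurations

theorem ENNReal.tsum_subtype_le_iff {α : Type*} {P : Set α} {φ : α → ℝ≥0∞} {C : ℝ≥0∞} :
    ∑' x : P, φ x ≤ C ↔ ∀ t : Finset α, (t : Set α) ⊆ P → ∑ x ∈ t, φ x ≤ C := by
  constructor
  · intro h t ht
    rw [← Finset.tsum_subtype]
    exact (ENNReal.tsum_mono_subtype φ (s := t) ht).trans h
  · intro h
    rw [ENNReal.tsum_eq_iSup_sum]
    refine iSup_le fun t => ?_
    refine (Finset.sum_map t (Function.Embedding.subtype (· ∈ P)) φ).symm.trans_le ?_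
    refine h _ fun x hx => ?_
    rw [Finset.mem_coe, Finset.mem_map] at hx
    obtain ⟨y, -, rfl⟩ := hx
    exact y.2

theorem Set.tsum_smul_set {G : Type*} [Group G] (P : Set G) (x : G) (φ : G → ℝ≥0∞) :
    ∑' y : (x • P : Set G), φ y = ∑' y : P, φ (x * y) := by
  let e : P ≃ (x • P : Set G) := Equiv.Set.image (fun y => x • y) _ (MulAction.injective x)
  rw [← e.tsum_eq]
  rfl

section Bounds

variable {G : Type*} (H : Type*) [NormedAddCommGroup H] [InnerProductSpace ℂ H]
  [RKHS ℂ H G ℂ]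

/-- The upper sampling bound `∑_{λ ∈ P} |f(λ)|² ≤ B ‖f‖²`. -/
def HasBesselBound (B : ℝ) (P : Set G) : Prop :=
  ∀ f : H, ∑' l : P, ‖f (l : G)‖ₑ ^ 2 ≤ ENNReal.ofReal (B * ‖f‖ ^ 2)

/-- The lower sampling bound `A ‖f‖² ≤ ∑_{λ ∈ P} |f(λ)|²`. -/
def HasLowerSamplingBound (A : ℝ) (P : Set G) : Prop :=
  ∀ f : H, ENNReal.ofReal (A * ‖f‖ ^ 2) ≤ ∑' l : P, ‖f (l : G)‖ₑ ^ 2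

/-- The lower Riesz bound `A ∑_{λ ∈ P} |c_λ|² ≤ ‖∑_{λ ∈ P} c_λ k_λ‖²`, for finite sums. -/
def HasLowerRieszBound [CompleteSpace H] (A : ℝ) (P : Set G) : Prop :=
  ∀ (t : Finset G) (g : G → G), InjOn g t → (∀ y ∈ t, g y ∈ P) → ∀ c : G → ℂ,
    A * ∑ y ∈ t, ‖c y‖ ^ 2 ≤ ‖∑ y ∈ t, c y • kernelVector H (g y)‖ ^ 2

end Bounds

section HullBounds

variable {G : Type*} [Group G] [TopologicalSpace G] [IsTopologicalGroup G]
  [LocallyCompactSpace G] [SecondCountableTopology G] [T2Space G]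
  [MeasurableSpace G] [BorelSpace G]
  {m : Measure G} [m.IsHaarMeasure] {σ : G → G → Circle} (hσ : IsContinuousTwoCocycle σ)
  {H : Type*} [NormedAddCommGroup H] [InnerProductSpace ℂ H] [CompleteSpace H] [RKHS ℂ H G ℂ]
  (hL2 : IsIsometricInL2 H m) (hinv : IsTwistedInvariant H σ)

include hσ hL2 hinv

theorem continuous_enorm_sq (f : H) : Continuous fun x : G => ‖f x‖ₑ ^ 2 :=
  (ENNReal.continuous_pow 2).comp (continuous_coe hσ hL2 hinv f).enorm

/-- The values of `f` on `x • P` are, up to phases, those of a unit translate of `f` on `P`. -/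
theorem exists_translate_tsum_eq (P : Set G) (x : G) (f : H) :
    ∃ g : H, ‖g‖ = ‖f‖ ∧ ∑' y : (x • P : Set G), ‖f y‖ₑ ^ 2 = ∑' y : P, ‖g y‖ₑ ^ 2 := by
  refine ⟨twistedShift hσ hL2 hinv x⁻¹ f, LinearIsometryEquiv.norm_map _ _, ?_⟩
  rw [Set.tsum_smul_set P x fun y => ‖f y‖ₑ ^ 2]
  refine tsum_congr fun y => ?_
  rw [← ofReal_norm, ← ofReal_norm, norm_twistedShift_apply, inv_inv]

theorem HasBesselBound.smul {B : ℝ} {P : Set G} (h : HasBesselBound H B P) (x : G) :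
    HasBesselBound H B (x • P) := fun f => by
  obtain ⟨g, hg, hfg⟩ := exists_translate_tsum_eq hσ hL2 hinv P x f
  rw [hfg, ← hg]
  exact h g

theorem HasLowerSamplingBound.smul {A : ℝ} {P : Set G} (h : HasLowerSamplingBound H A P) (x : G) :
    HasLowerSamplingBound H A (x • P) := fun f => by
  obtain ⟨g, hg, hfg⟩ := exists_translate_tsum_eq hσ hL2 hinv P x f
  rw [hfg, ← hg]
  exact h g

theorem HasLowerRieszBound.smul {A : ℝ} {P : Set G} (h : HasLowerRieszBound H A P) (x : G) :
    HasLowerRieszBound H A (x • P) := fun t g hg hgP c => by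
  have h1 := h t (fun y => x⁻¹ * g y) (fun y hy z hz hyz => hg hy hz (mul_left_cancel hyz))
    (fun y hy => Set.mem_smul_set_iff_inv_smul_mem.1 (hgP y hy))
    -- The phases relating `k_{xy}` to the translate of `k_y` are absorbed into the coefficients,
    -- whose moduli do not change.
    (fun y => ((σ x (x⁻¹ * g y))⁻¹ : Circle) • c y)
  have h2 : ∑ y ∈ t, c y • kernelVector H (g y) = twistedShift hσ hL2 hinv x
      (∑ y ∈ t, (((σ x (x⁻¹ * g y))⁻¹ : Circle) • c y) • kernelVector H (x⁻¹ * g y)) := by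
    rw [map_sum]
    refine Finset.sum_congr rfl fun y _ => ?_
    have h3 := twistedShift_kernelVector hσ hL2 hinv x (x⁻¹ * g y)
    rw [mul_inv_cancel_left] at h3
    rw [map_smul, ← h3, smul_comm, smul_assoc]
  rw [h2, LinearIsometryEquiv.norm_map]
  refine le_trans (le_of_eq ?_) h1
  congr 1
  refine Finset.sum_congr rfl fun y _ => ?_
  rw [Circle.smul_def, smul_eq_mul, norm_mul, Circle.norm_coe, one_mul]

/-- A violation is visible on finitely many points and is an open condition on their positions, so
distinct points of some translate of `Λ` would violate the bound too. -/
theorem HasBesselBound.of_mem_hull {B : ℝ} {Λ : Set G} (h : HasBesselBound H B Λ)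
    {P : ClosedSubsets G} (hP : P ∈ hull Λ) : HasBesselBound H B (P : Set G) := fun f => by
  refine (ENNReal.tsum_subtype_le_iff (φ := fun y => ‖f y‖ₑ ^ 2)).2 fun t ht => ?_
  by_contra! hlt
  have hc : Continuous fun g : G → G => ∑ y ∈ t, ‖f (g y)‖ₑ ^ 2 :=
    continuous_finsetSum _ fun y _ =>
      (continuous_enorm_sq hσ hL2 hinv f).comp (continuous_apply y)
  obtain ⟨x, g, hgs, hg, hgt⟩ := exists_translate_configuration hP t ht
    ((isOpen_lt continuous_const hc).mem_nhds hlt)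
  classical
  change ENNReal.ofReal (B * ‖f‖ ^ 2) < ∑ y ∈ t, ‖f (g y)‖ₑ ^ 2 at hgs
  refine hgs.not_ge ?_
  rw [← Finset.sum_image (f := fun z => ‖f z‖ₑ ^ 2) hg]
  refine (ENNReal.tsum_subtype_le_iff (φ := fun y => ‖f y‖ₑ ^ 2)).1
    (h.smul hσ hL2 hinv x f) _ ?_
  intro z hz
  rw [Finset.coe_image] at hz
  obtain ⟨y, hy, rfl⟩ := hz
  exact hgt y hy

theorem HasLowerRieszBound.of_mem_hull {A : ℝ} {Λ : Set G} (h : HasLowerRieszBound H A Λ)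
    {P : ClosedSubsets G} (hP : P ∈ hull Λ) : HasLowerRieszBound H A (P : Set G) := by
  intro t g hg hgP c
  by_contra! hlt
  have hk := continuous_kernelVector hσ hL2 hinv
  have hc : Continuous fun u : G → G => ‖∑ y ∈ t, c y • kernelVector H (u (g y))‖ ^ 2 :=
    (continuous_finsetSum _ fun y _ =>
      (hk.comp (continuous_apply (g y))).const_smul (c y)).norm.pow 2
  classical
  obtain ⟨x, u, hus, hu, hut⟩ := exists_translate_configuration hP (t.image g)
    (by rw [Finset.coe_image]; rintro _ ⟨y, hy, rfl⟩; exact hgP y hy)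
    ((isOpen_lt hc continuous_const).mem_nhds hlt)
  refine (h.smul hσ hL2 hinv x t (u ∘ g) ?_ ?_ c).not_gt hus
  · rw [Finset.coe_image] at hu
    exact hu.comp hg (mapsTo_image _ _)
  · exact fun y hy => hut (g y) (Finset.mem_image_of_mem g hy)

end HullBounds

/-! ### Localization: separated sums, uniform tails, and lower sampling bounds on the hull -/

section Amalgam

variable {G : Type*} [Group G] [TopologicalSpace G] [IsTopologicalGroup G]
  [LocallyCompactSpace G] [SecondCountableTopology G] [T2Space G]
  [MeasurableSpace G] [BorelSpace G] {m : Measure G} [m.IsHaarMeasure]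

/-- The local maximal function of a continuous function is measurable. -/
theorem measurable_iSup_smul {φ : G → ℝ≥0∞} (hφ : Continuous φ) (W : Set G) :
    Measurable fun x : G => ⨆ t ∈ x • W, φ t := by
  have h : (fun x : G => ⨆ t ∈ x • W, φ t) = fun x => ⨆ w ∈ W, φ (x * w) := by
    ext x
    exact iSup_image (f := fun w => x * w) (g := φ)
  rw [h]
  refine LowerSemicontinuous.measurable (lowerSemicontinuous_iSup fun w =>
    lowerSemicontinuous_iSup fun _ => ?_)
  exact (hφ.comp (continuous_mul_const w)).lowerSemicontinuous

/-- The sum of a function over a separated set is controlled by the integral of its local maximal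
function. -/
theorem IsSeparatedBy.mul_tsum_le {W : Set G} (hW : IsOpen W) (hWinv : W⁻¹ = W) {ℓ : ℕ}
    {P : Set G} (hP : IsSeparatedBy W ℓ P) {φ : G → ℝ≥0∞} (hφ : Continuous φ) {S L : Set G}
    (hSP : S ⊆ P) (hSL : ∀ y ∈ S, y • W ⊆ L) :
    m W * ∑' y : S, φ y ≤ ℓ * ∫⁻ x in L, ⨆ t ∈ x • W, φ t ∂m := by
  set φs : G → ℝ≥0∞ := fun x => ⨆ t ∈ x • W, φ t with hφs
  have hφsm : Measurable φs := measurable_iSup_smul hφ W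
  have hmem : ∀ x y : G, x ∈ y • W ↔ y ∈ x • W := by
    intro x y
    rw [Set.mem_smul_set_iff_inv_smul_mem, Set.mem_smul_set_iff_inv_smul_mem, ← hWinv,
      Set.mem_inv, smul_eq_mul, mul_inv_rev, inv_inv, smul_eq_mul, hWinv]
  rw [← ENNReal.tsum_mul_left]
  refine ENNReal.tsum_subtype_le_iff (φ := fun y => m W * φ y).2 fun t ht => ?_
  calc ∑ y ∈ t, m W * φ y ≤ ∑ y ∈ t, ∫⁻ x in L, (y • W).indicator 1 x * φs x ∂m := by
        refine Finset.sum_le_sum fun y hy => ?_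
        have hyW : MeasurableSet (y • W) := (hW.smul y).measurableSet
        calc m W * φ y = ∫⁻ x in L, (y • W).indicator 1 x * φ y ∂m := by
              rw [lintegral_mul_const _ (measurable_one.indicator hyW),
                lintegral_indicator_one hyW, Measure.restrict_apply hyW,
                inter_eq_left.2 (hSL y (ht hy)), measure_smul]
          _ ≤ _ := by
              refine lintegral_mono fun x => ?_
              by_cases hx : x ∈ y • W
              · simp only [hx, indicator_of_mem, Pi.one_apply, one_mul]
                exact le_iSup₂ (f := fun t (_ : t ∈ x • W) => φ t) y ((hmem x y).1 hx)
              · simp [hx]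
    _ = ∫⁻ x in L, ∑ y ∈ t, (y • W).indicator 1 x * φs x ∂m := by
        rw [lintegral_finsetSum]
        exact fun y _ => (measurable_one.indicator (hW.smul y).measurableSet).mul hφsm
    _ ≤ ∫⁻ x in L, ℓ * φs x ∂m := by
        -- By symmetry of `W`, the `y ∈ t` with `x ∈ y • W` are those lying in `x • W`, so there are
        -- at most `ℓ` of them.
        refine lintegral_mono fun x => ?_
        rw [← Finset.sum_mul]
        gcongr
        classical
        have h1 : ∑ y ∈ t, (y • W).indicator (1 : G → ℝ≥0∞) x =
            ((t.filter fun y => x ∈ y • W).card : ℝ≥0∞) := by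
          simp [indicator_apply, Finset.sum_boole]
        rw [h1]
        have h2 : ((t.filter fun y => x ∈ y • W).card : ℕ∞) ≤ ℓ := by
          rw [← encard_coe_eq_coe_finsetCard]
          refine (encard_le_encard fun y hy => ?_).trans (hP x)
          simp only [Finset.coe_filter, mem_ofPred_eq] at hy
          exact ⟨hSP (ht hy.1), (hmem x y).1 hy.2⟩
        exact_mod_cast h2
    _ = ℓ * ∫⁻ x in L, φs x ∂m := lintegral_const_mul _ hφsm

variable {σ : G → G → Circle} (hσ : IsContinuousTwoCocycle σ)
  {H : Type*} [NormedAddCommGroup H] [InnerProductSpace ℂ H] [CompleteSpace H] [RKHS ℂ H G ℂ]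
  (hL2 : IsIsometricInL2 H m) (hinv : IsTwistedInvariant H σ) (hloc : IsLocalized H m)

include hloc in
-- Shrinking the window only decreases the local maximal function, so it may be taken open,
-- symmetric and inside a separating neighbourhood.
theorem IsLocalized.exists_symm_nhds {U : Set G} (hU : U ∈ 𝓝 (1 : G)) :
    ∃ W Q : Set G, IsOpen W ∧ (1 : G) ∈ W ∧ W⁻¹ = W ∧ W ⊆ U ∧ W ⊆ Q ∧ IsCompact Q ∧
      ∀ f : H, ∫⁻ x, ⨆ t ∈ x • W, ‖f t‖ₑ ^ 2 ∂m < ∞ := by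
  obtain ⟨Q, hQ, hQ1, hf⟩ := hloc
  obtain ⟨V, hVUQ, hV, hV1⟩ := mem_nhds_iff.1 (Filter.inter_mem hU hQ1)
  refine ⟨V ∩ V⁻¹, Q, hV.inter hV.inv, ⟨hV1, by simpa using hV1⟩, by simp [inter_comm],
    fun x hx => (hVUQ hx.1).1, fun x hx => (hVUQ hx.1).2, hQ, fun f => ?_⟩
  refine (lintegral_mono fun x => ?_).trans_lt (hf f)
  exact biSup_mono fun t ht => smul_set_mono (fun x hx => (hVUQ hx.1).2) ht

include hσ hL2 hinv hloc

theorem IsRelativelySeparated.tsum_lt_top {Λ : Set G} (h : IsRelativelySeparated Λ) (f : H) :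
    ∑' y : Λ, ‖f y‖ₑ ^ 2 < ∞ := by
  obtain ⟨U, hU, hU1, ℓ, hℓ⟩ := h.exists_isSeparatedBy
  obtain ⟨W, Q, hW, hW1, hWinv, hWU, -, -, hf⟩ := hloc.exists_symm_nhds (hU.mem_nhds hU1)
  have h1 := (hℓ.mono hWU).mul_tsum_le (m := m) hW hWinv (continuous_enorm_sq hσ hL2 hinv f) (L := univ)
    subset_rfl (fun _ _ => subset_univ _)
  rw [Measure.restrict_univ] at h1
  by_contra htop
  rw [not_lt, top_le_iff] at htop
  rw [htop, ENNReal.mul_top (hW.measure_pos m ⟨1, hW1⟩).ne', top_le_iff] at h1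
  exact ENNReal.mul_ne_top (ENNReal.natCast_ne_top ℓ) (hf f).ne h1

/-- The sums of `|f|²` over separated sets have uniformly small tails. -/
theorem exists_compact_tsum_diff_le {U : Set G} (hU : U ∈ 𝓝 (1 : G)) (ℓ : ℕ) (f : H)
    {ε : ℝ≥0∞} (hε : ε ≠ 0) : ∃ K : Set G, IsCompact K ∧ ∀ P : Set G, IsSeparatedBy U ℓ P →
      ∑' y : (P \ K : Set G), ‖f y‖ₑ ^ 2 ≤ ε := by
  obtain ⟨W, Q, hW, hW1, hWinv, hWU, hWQ, hQ, hf⟩ := hloc.exists_symm_nhds hU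
  have hc := continuous_enorm_sq hσ hL2 hinv f
  set φs : G → ℝ≥0∞ := fun x => ⨆ t ∈ x • W, ‖f t‖ₑ ^ 2 with hφs
  have hφsm : Measurable φs := measurable_iSup_smul hc W
  have hmW0 : m W ≠ 0 := (hW.measure_pos m ⟨1, hW1⟩).ne'
  have hmWt : m W ≠ ∞ := ((measure_mono hWQ).trans_lt hQ.measure_lt_top).ne
  have htend : Tendsto (fun n => ∫⁻ x in (compactCovering G n)ᶜ, φs x ∂m) atTop (𝓝 0) := by
    have hm : ∀ n, MeasurableSet (compactCovering G n)ᶜ := fun n =>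
      (isCompact_compactCovering G n).measurableSet.compl
    have h := tendsto_measure_iInter_atTop (μ := m.withDensity φs)
      (s := fun n => (compactCovering G n)ᶜ) (fun n => (hm n).nullMeasurableSet)
      (fun a b hab => compl_subset_compl.2 (compactCovering_subset G hab))
      ⟨0, by
        rw [withDensity_apply _ (hm 0)]
        exact ((setLIntegral_le_lintegral _ _).trans_lt (hf f)).ne⟩
    rw [← compl_iUnion, iUnion_compactCovering, compl_univ, measure_empty] at h
    convert h using 2 with n
    rw [Function.comp_apply, withDensity_apply _ (hm n)]
  have htend2 : Tendsto (fun n => ℓ * ∫⁻ x in (compactCovering G n)ᶜ, φs x ∂m) atTop (𝓝 0) := by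
    simpa using ENNReal.Tendsto.const_mul htend (Or.inr (ENNReal.natCast_ne_top ℓ))
  obtain ⟨n, hn⟩ := (htend2.eventually (gt_mem_nhds
    (pos_iff_ne_zero.2 (mul_ne_zero hmW0 hε)))).exists
  -- The factor `Q` keeps `y • W` off the `n`-th compact set for every `y` outside the product: if
  -- `y w` were in that set, then `y = (y w) w⁻¹` with `w⁻¹ ∈ W ⊆ Q`.
  refine ⟨compactCovering G n * Q, (isCompact_compactCovering G n).mul hQ, fun P hP => ?_⟩
  have h1 := (hP.mono hWU).mul_tsum_le (m := m) hW hWinv hc (S := P \ (compactCovering G n * Q))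
    (L := (compactCovering G n)ᶜ) sdiff_subset (fun y hy x hx hxn => by
      refine hy.2 ?_
      obtain ⟨w, hw, rfl⟩ := hx
      refine ⟨y * w, hxn, w⁻¹, hWQ (hWinv ▸ Set.inv_mem_inv.2 hw), by simp⟩)
  exact (ENNReal.mul_le_mul_iff_right hmW0 hmWt).1 (h1.trans hn.le)

/-- A lower sampling bound for a separated set passes to the hull, up to the multiplicity. -/
theorem HasLowerSamplingBound.of_mem_hull {A : ℝ} {Λ : Set G} (h : HasLowerSamplingBound H A Λ)
    {U : Set G} (hU : IsOpen U) (hU1 : (1 : G) ∈ U) {ℓ : ℕ} (hℓ : IsSeparatedBy U ℓ Λ)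
    {P : ClosedSubsets G} (hP : P ∈ hull Λ) (f : H) :
    ENNReal.ofReal (A * ‖f‖ ^ 2) ≤ ℓ * ∑' l : (P : Set G), ‖f (l : G)‖ₑ ^ 2 := by
  set φ : G → ℝ≥0∞ := fun x => ‖f x‖ₑ ^ 2 with hφ
  have hc : Continuous φ := continuous_enorm_sq hσ hL2 hinv f
  have hPsep := hℓ.of_mem_hull hU hP
  refine ENNReal.le_of_forall_pos_le_add fun ε hε _ => ?_
  obtain ⟨K, hK, hKtail⟩ := exists_compact_tsum_diff_le hσ hL2 hinv hloc (hU.mem_nhds hU1) ℓ f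
    (ε := ε / 2) (by simpa using hε.ne')
  have hPK : ((P : Set G) ∩ K).Finite := by
    obtain ⟨s, -, hs⟩ := hK.elim_nhds_subcover (fun x => x • U)
      fun x _ => (hU.smul x).mem_nhds ⟨1, hU1, by simp⟩
    refine (s.finite_toSet.biUnion (t := fun x => (P : Set G) ∩ x • U) fun x _ =>
      finite_of_encard_le_coe (hPsep x)).subset ?_
    rintro y ⟨hyP, hyK⟩
    obtain ⟨x, hx, hyx⟩ := mem_iUnion₂.1 (hs hyK)
    exact mem_iUnion₂.2 ⟨x, hx, hyP, hyx⟩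
  set t := hPK.toFinset with ht
  -- At most `ℓ` points gather near each of the `t.card` points of `P` in `K`, so the total error is
  -- at most `ε / 2`. The `+ 1` keeps the denominator nonzero.
  set δ : ℝ≥0∞ := ε / 2 / (ℓ * t.card + 1) with hδ
  have hδ0 : δ ≠ 0 := by
    refine (ENNReal.div_pos ?_ ?_).ne'
    · simpa using hε.ne'
    · exact ENNReal.add_ne_top.2 ⟨ENNReal.mul_ne_top (ENNReal.natCast_ne_top _)
        (ENNReal.natCast_ne_top _), ENNReal.one_ne_top⟩
  have hV : ∀ p : G, ∃ V : Set G, IsOpen V ∧ p ∈ V ∧ V ⊆ p • U ∧ ∀ y ∈ V, φ y ≤ φ p + δ := by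
    intro p
    refine ⟨p • U ∩ φ ⁻¹' Iio (φ p + δ), (hU.smul p).inter (isOpen_Iio.preimage hc),
      ⟨⟨1, hU1, by simp⟩, ?_⟩, inter_subset_left, fun y hy => le_of_lt hy.2⟩
    exact ENNReal.lt_add_right (by simp [hφ]) hδ0
  choose V hVo hpV hVU hVφ using hV
  -- Only the avoidance condition is needed here: inside `K`, every point of `x • Λ` is close to
  -- some point of `P`.
  obtain ⟨x, -, hx⟩ := exists_translate_of_mem_hull hP (ι := Empty) (V := fun _ => ∅) nofun nofun
    (K := K \ ⋃ p ∈ t, V p) (hK.diff (isOpen_biUnion fun p _ => hVo p)) (by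
      refine eq_empty_of_forall_notMem ?_
      rintro y ⟨hyP, hyK, hyV⟩
      exact hyV (mem_iUnion₂.2 ⟨y, hPK.mem_toFinset.2 ⟨hyP, hyK⟩, hpV y⟩))
  have hxsep : IsSeparatedBy U ℓ (x • Λ) := hℓ.smul x
  have hpart : ∀ p ∈ t, ∑' y : (x • Λ ∩ V p : Set G), φ y ≤ ℓ * (φ p + δ) := by
    intro p _
    calc ∑' y : (x • Λ ∩ V p : Set G), φ y ≤ ∑' y : (x • Λ ∩ V p : Set G), (φ p + δ) :=
          ENNReal.tsum_le_tsum fun y => hVφ p y y.2.2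
      _ = (x • Λ ∩ V p).encard * (φ p + δ) := ENNReal.tsum_set_const _ _
      _ ≤ ℓ * (φ p + δ) := by
          gcongr
          have := ENat.toENNReal_le.2
            ((encard_le_encard (inter_subset_inter_right _ (hVU p))).trans (hxsep p))
          simpa using this
  calc ENNReal.ofReal (A * ‖f‖ ^ 2) ≤ ∑' y : (x • Λ : Set G), φ y := h.smul hσ hL2 hinv x f
    _ ≤ ∑' y : ((⋃ p ∈ t, x • Λ ∩ V p) ∪ (x • Λ) \ K : Set G), φ y := by
        refine ENNReal.tsum_mono_subtype φ fun y hy => ?_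
        by_cases hyK : y ∈ K
        · left
          by_contra hyV
          refine (Set.ext_iff.1 hx y).1 ⟨hy, hyK, fun hyV' => hyV ?_⟩
          obtain ⟨p, hp, hyp⟩ := mem_iUnion₂.1 hyV'
          exact mem_iUnion₂.2 ⟨p, hp, hy, hyp⟩
        · exact Or.inr ⟨hy, hyK⟩
    _ ≤ ∑ p ∈ t, ℓ * (φ p + δ) + ε / 2 := by
        refine (ENNReal.tsum_union_le φ _ _).trans (add_le_add ?_ (hKtail _ hxsep))
        exact (ENNReal.tsum_biUnion_le φ t _).trans (Finset.sum_le_sum hpart)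
    _ = ℓ * ∑ p ∈ t, φ p + ℓ * t.card * δ + ε / 2 := by
        simp_rw [mul_add, Finset.sum_add_distrib, Finset.mul_sum]
        simp [mul_left_comm, mul_assoc]
    _ ≤ ℓ * ∑' l : (P : Set G), φ l + ε / 2 + ε / 2 := by
        gcongr
        · exact ENNReal.tsum_subtype_le_iff.1 le_rfl t fun y hy =>
            (hPK.mem_toFinset.1 hy).1
        · calc (ℓ * t.card : ℝ≥0∞) * δ ≤ (ℓ * t.card + 1) * δ := by gcongr; exact le_self_add
            _ ≤ ε / 2 := ENNReal.mul_div_le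
    _ = ℓ * ∑' l : (P : Set G), φ l + ε := by rw [add_assoc, ENNReal.add_halves]

end Amalgam

/-! ### Separation and bounds of sets of sampling and interpolation -/

section SamplingInterpolation

variable {G : Type*} [Group G] [TopologicalSpace G] [IsTopologicalGroup G]
  [LocallyCompactSpace G] [SecondCountableTopology G] [T2Space G]
  [MeasurableSpace G] [BorelSpace G]
  {m : Measure G} [m.IsHaarMeasure] {σ : G → G → Circle} (hσ : IsContinuousTwoCocycle σ)
  {H : Type*} [NormedAddCommGroup H] [InnerProductSpace ℂ H] [CompleteSpace H] [RKHS ℂ H G ℂ]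
  (hL2 : IsIsometricInL2 H m) (hinv : IsTwistedInvariant H σ)

include hσ hL2 hinv in
-- Testing on translates of `k_e`: since `k_e(e) = ‖k_e‖² ≠ 0`, `|k_e|²` exceeds some `δ > 0` near
-- `e`, and each point of `Λ` in `x • U` adds at least `δ` to the Bessel sum of the translate by
-- `x`.
theorem HasBesselBound.isRelativelySeparated [Nontrivial H] {B : ℝ} {Λ : Set G}
    (h : HasBesselBound H B Λ) : IsRelativelySeparated Λ := by
  set k : H := kernelVector H (1 : G) with hk
  have hk0 : k ≠ 0 := kernelVector_one_ne_zero hσ hL2 hinv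
  have hc := continuous_enorm_sq hσ hL2 hinv k
  have hk1 : ‖k 1‖ₑ ^ 2 ≠ 0 := by
    rw [← inner_kernelVector_left]
    simpa [hk] using hk0
  obtain ⟨δ, hδ0, hδ⟩ := exists_between (pos_iff_ne_zero.2 hk1)
  set U : Set G := (fun x => ‖k x‖ₑ ^ 2) ⁻¹' Ioi δ with hU
  have hUo : IsOpen U := isOpen_Ioi.preimage hc
  set C : ℝ≥0∞ := ENNReal.ofReal (B * ‖k‖ ^ 2) with hC
  have hbound : ∀ x : G, ((Λ ∩ x • U).encard : ℝ≥0∞) * δ ≤ C := by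
    intro x
    have h1 := h (twistedShift hσ hL2 hinv x k)
    rw [LinearIsometryEquiv.norm_map] at h1
    refine le_trans ?_ h1
    rw [← ENNReal.tsum_set_const]
    refine le_trans ?_ (ENNReal.tsum_mono_subtype
      (fun y => ‖twistedShift hσ hL2 hinv x k y‖ₑ ^ 2) (inter_subset_left (s := Λ) (t := x • U)))
    refine ENNReal.tsum_le_tsum fun y => ?_
    rw [← ofReal_norm, norm_twistedShift_apply, ofReal_norm]
    exact le_of_lt (Set.mem_smul_set_iff_inv_smul_mem.1 y.2.2)
  have hδt : δ ≠ ∞ := ne_top_of_lt hδ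
  obtain ⟨n, hn⟩ := ENNReal.exists_nat_gt
    (ENNReal.div_ne_top (ENNReal.ofReal_ne_top (r := B * ‖k‖ ^ 2)) hδ0.ne')
  refine ⟨U, hUo, ⟨1, hδ⟩, n, fun x => ENat.toENNReal_le.1 ?_⟩
  have h2 : ((Λ ∩ x • U).encard : ℝ≥0∞) ≤ C / δ :=
    (ENNReal.le_div_iff_mul_le (Or.inl hδ0.ne') (Or.inl hδt)).2 (hbound x)
  simpa using h2.trans hn.le

/-- Duality: if `f` interpolates `d`, then `⟨c, d⟩ = ⟨∑ c_λ k_λ, f⟩` for finite `c`. The functionals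
`c / ‖∑ c_λ k_λ‖` on `ℓ²` are thus pointwise bounded by `‖f‖`, and the uniform boundedness principle
gives `‖c‖ ≤ C ‖∑ c_λ k_λ‖`. -/
theorem IsSetOfInterpolation.exists_hasLowerRieszBound {Λ : Set G}
    (h : IsSetOfInterpolation H Λ) : ∃ A : ℝ, 0 < A ∧ HasLowerRieszBound H A Λ := by
  classical
  let E := lp (fun _ : Λ => ℂ) 2
  let v : (Finset Λ × (Λ → ℂ)) → E := fun p => ∑ y ∈ p.1, lp.single 2 y (p.2 y)
  let w : (Finset Λ × (Λ → ℂ)) → H := fun p => ∑ y ∈ p.1, p.2 y • kernelVector H (y : G)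
  have hvw : ∀ p (d : E) (f : H), (∀ l : Λ, f (l : G) = d l) →
      inner ℂ (v p) d = inner ℂ (w p) f := by
    intro p d f hf
    rw [sum_inner, sum_inner]
    refine Finset.sum_congr rfl fun y _ => ?_
    rw [lp.inner_single_left, inner_smul_left, inner_kernelVector_left, hf]
    simp [mul_comm]
  -- Dividing by numbers strictly above `‖w‖` avoids a division by zero, as `w = 0` is not yet
  -- excluded. They later decrease to `‖w‖`.
  let ι := {q : (Finset Λ × (Λ → ℂ)) × ℝ // ‖w q.1‖ < q.2}
  let g : ι → E →L[ℂ] ℂ := fun q => ((q.1.2)⁻¹ : ℝ) • innerSL ℂ (v q.1.1)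
  have hpos : ∀ q : ι, 0 < q.1.2 := fun q => (norm_nonneg _).trans_lt q.2
  obtain ⟨C, hC⟩ := banach_steinhaus (g := g) fun d => by
    obtain ⟨f, hf⟩ := h d
    refine ⟨‖f‖, fun q => ?_⟩
    change ‖((q.1.2)⁻¹ : ℝ) • inner ℂ (v q.1.1) d‖ ≤ _
    rw [hvw _ d f hf, norm_smul, norm_inv, Real.norm_of_nonneg (hpos q).le,
      inv_mul_le_iff₀ (hpos q)]
    exact (norm_inner_le_norm _ _).trans (mul_le_mul_of_nonneg_right q.2.le (norm_nonneg _))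
  have hvC : ∀ p, ‖v p‖ ≤ max C 1 * ‖w p‖ := by
    intro p
    refine le_of_forall_pos_le_add fun ε hε => ?_
    have hC1 : 0 < max C 1 := lt_of_lt_of_le one_pos (le_max_right _ _)
    have hlt : ‖w p‖ < ‖w p‖ + ε / max C 1 := lt_add_of_pos_right _ (div_pos hε hC1)
    have h1 := hC ⟨(p, ‖w p‖ + ε / max C 1), hlt⟩
    have h2 : ‖(‖w p‖ + ε / max C 1)⁻¹ • innerSL ℂ (v p)‖ ≤ C := h1
    have hp := (norm_nonneg (w p)).trans_lt hlt
    rw [norm_smul, norm_inv, Real.norm_of_nonneg hp.le, inv_mul_le_iff₀ hp,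
      innerSL_apply_norm] at h2
    calc ‖v p‖ ≤ (‖w p‖ + ε / max C 1) * C := h2
      _ ≤ (‖w p‖ + ε / max C 1) * max C 1 := by gcongr; exact le_max_left _ _
      _ = max C 1 * ‖w p‖ + ε := by field_simp
  refine ⟨(max C 1 ^ 2)⁻¹, by positivity, fun t u hu hut c => ?_⟩
  rcases t.eq_empty_or_nonempty with rfl | hne
  · simp
  obtain ⟨y₀, hy₀⟩ := hne
  -- The value off `t` is irrelevant. It only has to lie in `Λ`, which is why the empty `t` is
  -- treated separately.
  let u' : G → Λ := fun y => if hy : y ∈ t then ⟨u y, hut y hy⟩ else ⟨u y₀, hut y₀ hy₀⟩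
  have hu'u : ∀ y ∈ t, (u' y : G) = u y := fun y hy => by simp [u', hy]
  have hu' : InjOn u' t := fun y hy z hz hyz => hu hy hz (by
    rw [← hu'u y hy, ← hu'u z hz, hyz])
  let c' : Λ → ℂ := fun l => c (Function.invFunOn u' t l)
  have hc' : ∀ y ∈ t, c' (u' y) = c y := fun y hy => by
    rw [show c' (u' y) = c (Function.invFunOn u' t (u' y)) from rfl,
      hu'.leftInvOn_invFunOn hy]
  have h1 := hvC (t.image u', c')
  have hw : w (t.image u', c') = ∑ y ∈ t, c y • kernelVector H (u y) := by
    change ∑ y ∈ t.image u', _ = _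
    rw [Finset.sum_image hu']
    exact Finset.sum_congr rfl fun y hy => by
      change c' (u' y) • _ = _
      rw [hc' y hy, hu'u y hy]
  have hv : ‖v (t.image u', c')‖ ^ 2 = ∑ y ∈ t, ‖c y‖ ^ 2 := by
    have h2 := lp.norm_sum_single (p := 2) (by norm_num) c' (t.image u')
    simp only [ENNReal.toReal_ofNat, Real.rpow_ofNat] at h2
    change ‖∑ y ∈ t.image u', _‖ ^ 2 = _
    rw [h2, Finset.sum_image hu']
    exact Finset.sum_congr rfl fun y hy => by rw [hc' y hy]
  rw [← hv, ← hw, inv_mul_le_iff₀ (by positivity), ← mul_pow]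
  gcongr

include hσ hL2 hinv in
-- For distinct `y = x a` and `z = x b` in `Λ`, the Riesz bound gives `‖k_y - c k_z‖² ≥ 2A` for
-- every phase `c`. For `c = σ(y, a⁻¹ b)` this vector is a translate of `k_e - k_{a⁻¹b}`, which is
-- small when `a` and `b` are near `e`.
theorem HasLowerRieszBound.isRelativelySeparated {A : ℝ} (hA : 0 < A) {Λ : Set G}
    (h : HasLowerRieszBound H A Λ) : IsRelativelySeparated Λ := by
  set k : G → H := fun x => kernelVector H x with hk
  have hc : Continuous k := continuous_kernelVector hσ hL2 hinv
  have hV : {x : G | ‖k 1 - k x‖ ^ 2 < 2 * A} ∈ 𝓝 (1 : G) :=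
    (isOpen_lt ((continuous_const.sub hc).norm.pow 2) continuous_const).mem_nhds (by
      simpa [hk] using hA)
  obtain ⟨U, hU, -, hUinv, hUV⟩ := exists_closed_nhds_one_inv_eq_mul_subset hV
  refine ⟨interior U, isOpen_interior, ⟨1, mem_interior_iff_mem_nhds.2 hU⟩, 1, fun x => ?_⟩
  rw [Nat.cast_one, encard_le_one_iff]
  rintro y z ⟨hy, a, ha, rfl⟩ ⟨hz, b, hb, rfl⟩
  by_contra hne
  simp only [smul_eq_mul] at hy hz hne
  have hab : a⁻¹ * b ∈ {x : G | ‖k 1 - k x‖ ^ 2 < 2 * A} :=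
    hUV (Set.mul_mem_mul (hUinv ▸ Set.inv_mem_inv.2 (interior_subset ha)) (interior_subset hb))
  classical
  have hbxa : x * b = (x * a) * (a⁻¹ * b) := by group
  have h1 := h {x * a, x * b} id (injOn_id _) (by simp [hy, hz])
    (fun y => if y = x * a then 1 else -(σ (x * a) (a⁻¹ * b) : ℂ))
  rw [Finset.sum_pair hne, Finset.sum_pair hne] at h1
  simp only [if_true, if_neg (Ne.symm hne), norm_one, norm_neg, Circle.norm_coe, id] at h1
  have h2 : (1 : ℂ) • kernelVector H (x * a) +
      (-(σ (x * a) (a⁻¹ * b) : ℂ)) • kernelVector H (x * b) =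
      twistedShift hσ hL2 hinv (x * a) (k 1 - k (a⁻¹ * b)) := by
    rw [map_sub, hk]
    simp only
    rw [twistedShift_kernelVector_one, one_smul, neg_smul, ← sub_eq_add_neg]
    congr 1
    conv_lhs => rw [hbxa]
    rw [← twistedShift_kernelVector hσ hL2 hinv, ← Circle.smul_def, smul_inv_smul]
  rw [h2, LinearIsometryEquiv.norm_map] at h1
  have h3 : ‖k 1 - k (a⁻¹ * b)‖ ^ 2 < 2 * A := hab
  linarith

/-- If all restrictions to `Λ` are square-summable, then `Λ` has a Bessel bound. -/
theorem exists_hasBesselBound {Λ : Set G} (h : ∀ f : H, ∑' y : Λ, ‖f y‖ₑ ^ 2 < ∞) :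
    ∃ B : ℝ, 0 < B ∧ HasBesselBound H B Λ := by
  classical
  -- Finite truncations of the restriction map: each is bounded, and the hypothesis bounds them
  -- pointwise.
  let R : Finset Λ → H →L[ℂ] lp (fun _ : Λ => ℂ) 2 := fun t =>
    ∑ y ∈ t, (innerSL ℂ (kernelVector H (y : G))).smulRight (lp.single 2 y (1 : ℂ))
  have hR : ∀ t f, ‖R t f‖ ^ 2 = ∑ y ∈ t, ‖f (y : G)‖ ^ 2 := by
    intro t f
    have h1 : R t f = ∑ y ∈ t, lp.single 2 y (f (y : G)) := by
      rw [FunLike.coe_sum, Finset.sum_apply]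
      refine Finset.sum_congr rfl fun y _ => ?_
      rw [ContinuousLinearMap.smulRight_apply, innerSL_apply_apply, inner_kernelVector_left,
        ← lp.single_smul, smul_eq_mul, mul_one]
    have h2 := lp.norm_sum_single (p := 2) (E := fun _ : Λ => ℂ) (by norm_num)
      (fun y : Λ => f (y : G)) t
    simp only [ENNReal.toReal_ofNat, Real.rpow_ofNat] at h2
    rw [h1, h2]
  have hsum : ∀ (t : Finset Λ) (f : H),
      ∑ y ∈ t, ‖f (y : G)‖ₑ ^ 2 = ENNReal.ofReal (∑ y ∈ t, ‖f (y : G)‖ ^ 2) := by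
    intro t f
    rw [ENNReal.ofReal_sum_of_nonneg fun _ _ => by positivity]
    refine Finset.sum_congr rfl fun y _ => ?_
    rw [ENNReal.ofReal_pow (norm_nonneg _), ofReal_norm]
  obtain ⟨C, hC⟩ := banach_steinhaus (g := R) fun f => by
    refine ⟨√(∑' y : Λ, ‖f y‖ₑ ^ 2).toReal, fun t => Real.le_sqrt_of_sq_le ?_⟩
    rw [hR, ← ENNReal.ofReal_le_iff_le_toReal (h f).ne, ← hsum]
    exact ENNReal.sum_le_tsum t
  refine ⟨max C 1 ^ 2, by positivity, fun f => ?_⟩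
  rw [ENNReal.tsum_eq_iSup_sum]
  refine iSup_le fun t => ?_
  rw [hsum, ← hR, ← mul_pow]
  gcongr
  exact ((R t).le_opNorm f).trans (by gcongr; exact (hC t).trans (le_max_left _ _))

end SamplingInterpolation

/-! ### Polynomial calculus for positive operators -/

section OperatorCalculus

open Polynomial

/-- Weierstrass approximation of `1/√t` on `[A, B]`. With error `d`, `t p² - 1 = t d² + 2 √t d`,
which accounts for the constant `|B| + 2√|B| + 1` once `|d| ≤ 1`. -/
theorem exists_polynomial_mul_sq_near_one {A B ε : ℝ} (hA : 0 < A) (hε : 0 < ε) :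
    ∃ p : ℝ[X], ∀ t ∈ Icc A B, |t * p.eval t ^ 2 - 1| ≤ ε := by
  have hM : 0 < |B| + 2 * √|B| + 1 := by positivity
  obtain ⟨p, hp⟩ := exists_polynomial_near_of_continuousOn A B (fun t => (√t)⁻¹)
    (Real.continuous_sqrt.continuousOn.inv₀ fun t ht =>
      (Real.sqrt_pos.2 (hA.trans_le ht.1)).ne') (min 1 (ε / (|B| + 2 * √|B| + 1)))
    (lt_min one_pos (div_pos hε hM))
  refine ⟨p, fun t ht => ?_⟩
  have ht0 : 0 < t := hA.trans_le ht.1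
  have htB : t ≤ |B| := ht.2.trans (le_abs_self B)
  set s := √t with hs
  have hs0 : 0 < s := Real.sqrt_pos.2 ht0
  have hst : s ^ 2 = t := Real.sq_sqrt ht0.le
  have hsB : s ≤ √|B| := Real.sqrt_le_sqrt htB
  set d := p.eval t - s⁻¹ with hd
  have hd1 : |d| ≤ 1 := (hp t ht).le.trans (min_le_left _ _)
  have hd2 : |d| * (|B| + 2 * √|B| + 1) ≤ ε :=
    (le_div_iff₀ hM).1 ((hp t ht).le.trans (min_le_right _ _))
  have heq : t * p.eval t ^ 2 - 1 = t * d ^ 2 + 2 * s * d := by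
    have : p.eval t = d + s⁻¹ := by rw [hd]; ring
    rw [this, ← hst]
    field_simp
    ring
  rw [heq]
  calc |t * d ^ 2 + 2 * s * d| ≤ |t * d ^ 2| + |2 * s * d| := abs_add_le _ _
    _ = t * |d| * |d| + 2 * s * |d| := by
        rw [abs_mul, abs_mul, abs_of_pos ht0, abs_pow, abs_of_pos (by positivity : 0 < 2 * s)]
        ring
    _ ≤ |B| * |d| * 1 + 2 * √|B| * |d| := by gcongr
    _ ≤ |d| * (|B| + 2 * √|B| + 1) := by nlinarith [abs_nonneg d]
    _ ≤ ε := hd2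

variable {H : Type*} [NormedAddCommGroup H] [InnerProductSpace ℂ H] [CompleteSpace H]

theorem re_inner_aeval_nonneg {S : H →L[ℂ] H} (hS : IsSelfAdjoint S) {q : ℝ[X]}
    (hq : ∀ t ∈ spectrum ℝ S, 0 ≤ q.eval t) (f : H) : 0 ≤ (inner ℂ f (aeval S q f)).re := by
  have h1 : 0 ≤ cfc q.eval S := cfc_nonneg hq
  rw [cfc_polynomial q S] at h1
  exact ((ContinuousLinearMap.nonneg_iff_isPositive _).1 h1).re_inner_nonneg_right f

/-- The converse of `re_inner_aeval_nonneg`. It locates the spectrum from quadratic form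
inequalities, whereas the other direction turns inequalities on the spectrum into form inequalities.
-/
theorem nonneg_of_mem_spectrum {S : H →L[ℂ] H} (hS : IsSelfAdjoint S) {q : ℝ[X]}
    (hq : ∀ f, 0 ≤ (inner ℂ f (aeval S q f)).re) : ∀ t ∈ spectrum ℝ S, 0 ≤ q.eval t := by
  have hsa : IsSelfAdjoint (aeval S q) := by
    rw [← cfc_polynomial q S]
    exact cfc_predicate _ _
  have h1 : 0 ≤ cfc q.eval S := by
    rw [cfc_polynomial q S, ContinuousLinearMap.nonneg_iff_isPositive,
      ContinuousLinearMap.isPositive_def']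
    refine ⟨hsa, fun f => ?_⟩
    rw [ContinuousLinearMap.reApplyInnerSelf, ← inner_conj_symm, RCLike.conj_re]
    exact hq f
  exact (cfc_nonneg_iff q.eval S).1 h1

theorem isSelfAdjoint_aeval {S : H →L[ℂ] H} (hS : IsSelfAdjoint S) (q : ℝ[X]) :
    IsSelfAdjoint (aeval S q) := by
  rw [← cfc_polynomial q S]
  exact cfc_predicate _ _

theorem inner_self_re_eq_norm_sq (f : H) : (inner ℂ f f).re = ‖f‖ ^ 2 :=
  inner_self_eq_norm_sq (𝕜 := ℂ) f

theorem aeval_C_apply (S : H →L[ℂ] H) (c : ℝ) (f : H) : aeval S (C c) f = (c : ℂ) • f := by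
  rw [aeval_C, Algebra.algebraMap_eq_smul_one]
  simp

theorem re_inner_aeval_C (S : H →L[ℂ] H) (c : ℝ) (f : H) :
    (inner ℂ f (aeval S (C c) f)).re = c * ‖f‖ ^ 2 := by
  rw [aeval_C_apply, inner_smul_right, Complex.re_ofReal_mul, inner_self_re_eq_norm_sq]

theorem re_inner_aeval_sub (S : H →L[ℂ] H) (q r : ℝ[X]) (f : H) :
    (inner ℂ f (aeval S (q - r) f)).re =
      (inner ℂ f (aeval S q f)).re - (inner ℂ f (aeval S r f)).re := by
  simp

theorem re_inner_aeval_X_mul_sq {S : H →L[ℂ] H} (hS : IsSelfAdjoint S) (p : ℝ[X]) (f : H) :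
    (inner ℂ (aeval S p f) (S (aeval S p f))).re = (inner ℂ f (aeval S (X * p ^ 2) f)).re := by
  have h : aeval S (X * p ^ 2) = aeval S p * (S * aeval S p) := by
    have : X * p ^ 2 = p * (X * p) := by ring
    rw [this, map_mul, map_mul, aeval_X]
  have h2 : ∀ g, inner ℂ (aeval S p f) g = inner ℂ f (aeval S p g) := fun g => by
    rw [← ContinuousLinearMap.adjoint_inner_left, (isSelfAdjoint_aeval hS p).adjoint_eq]
  rw [h, h2]
  rfl

theorem norm_aeval_sq_of_apply_eq {S : H →L[ℂ] H} (hS : IsSelfAdjoint S) (p : ℝ[X]) {h k : H}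
    (hk : S h = k) : ‖aeval S p k‖ ^ 2 = (inner ℂ h (aeval S (X * (X * p ^ 2)) h)).re := by
  have h1 : aeval S p k = aeval S (X * p) h := by
    rw [mul_comm, map_mul, aeval_X, ← hk]
    rfl
  have h3 : aeval S (X * (X * p ^ 2)) = aeval S (X * p) * aeval S (X * p) := by
    rw [← map_mul]
    congr 1
    ring
  have h2 : ∀ g, inner ℂ (aeval S (X * p) h) g = inner ℂ h (aeval S (X * p) g) := fun g => by
    rw [← ContinuousLinearMap.adjoint_inner_left, (isSelfAdjoint_aeval hS (X * p)).adjoint_eq]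
  rw [h1, ← inner_self_re_eq_norm_sq, h3, h2]
  rfl

variable {S : H →L[ℂ] H} {A B ε : ℝ} {p : ℝ[X]}

theorem spectrum_subset_Icc (hS : IsSelfAdjoint S)
    (hA : ∀ f, A * ‖f‖ ^ 2 ≤ (inner ℂ f (S f)).re) (hB : ∀ f, (inner ℂ f (S f)).re ≤ B * ‖f‖ ^ 2) :
    spectrum ℝ S ⊆ Icc A B := by
  intro t ht
  have h1 := nonneg_of_mem_spectrum hS (q := X - C A) (fun f => by
    rw [re_inner_aeval_sub, re_inner_aeval_C, aeval_X]
    linarith [hA f]) t ht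
  have h2 := nonneg_of_mem_spectrum hS (q := C B - X) (fun f => by
    rw [re_inner_aeval_sub, re_inner_aeval_C, aeval_X]
    linarith [hB f]) t ht
  simp only [eval_sub, eval_X, eval_C] at h1 h2
  exact ⟨by linarith, by linarith⟩

/-- `S² ≥ A S` forces `t² ≥ A t` on the spectrum. The frame operator of a Riesz sequence may have a
kernel, so `0` has to be allowed. -/
theorem eq_zero_or_mem_Icc_of_mem_spectrum (hS : IsSelfAdjoint S)
    (h0 : ∀ f, 0 ≤ (inner ℂ f (S f)).re) (hA : ∀ f, A * (inner ℂ f (S f)).re ≤ ‖S f‖ ^ 2)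
    (hB : ∀ f, (inner ℂ f (S f)).re ≤ B * ‖f‖ ^ 2) {t : ℝ} (ht : t ∈ spectrum ℝ S) :
    t = 0 ∨ t ∈ Icc A B := by
  have hI := spectrum_subset_Icc (A := 0) hS (fun f => by simpa using h0 f) hB ht
  have h1 := nonneg_of_mem_spectrum hS (q := X * X - C A * X) (fun f => by
    rw [re_inner_aeval_sub, map_mul, map_mul, aeval_X, ContinuousLinearMap.mul_def,
      ContinuousLinearMap.comp_apply, ContinuousLinearMap.mul_def, ContinuousLinearMap.comp_apply,
      aeval_C_apply, inner_smul_right, Complex.re_ofReal_mul,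
      ← ContinuousLinearMap.adjoint_inner_left, hS.adjoint_eq, inner_self_re_eq_norm_sq]
    linarith [hA f]) t ht
  simp only [eval_sub, eval_X, eval_C, eval_mul] at h1
  rcases hI.1.eq_or_lt with h | h
  · exact Or.inl h.symm
  · exact Or.inr ⟨by nlinarith, hI.2⟩

/-- For `p² t ≈ 1` on the spectrum, `p(S)² S` is almost at least the identity. -/
theorem le_re_inner_aeval (hS : IsSelfAdjoint S) (hsp : spectrum ℝ S ⊆ Icc A B)
    (hp : ∀ t ∈ Icc A B, |t * p.eval t ^ 2 - 1| ≤ ε) (f : H) :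
    (1 - ε) * ‖f‖ ^ 2 ≤ (inner ℂ (aeval S p f) (S (aeval S p f))).re := by
  rw [re_inner_aeval_X_mul_sq hS]
  have := re_inner_aeval_nonneg hS (q := X * p ^ 2 - C (1 - ε)) (fun t ht => by
    have := (abs_le.1 (hp t (hsp ht))).1
    simp only [eval_sub, eval_mul, eval_X, eval_pow, eval_C]
    linarith) f
  rw [re_inner_aeval_sub, re_inner_aeval_C] at this
  linarith

/-- With `h = S⁻¹ k` and `a = ⟨h, S h⟩ = ⟨h, k⟩`, the rank-one domination at `h` reads `a² ≤ a`, so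
`a ≤ 1`. Moreover `‖p(S) k‖² = ⟨h, S² p(S)² h⟩ ≤ (1 + ε) a`. -/
theorem norm_aeval_sq_le (hA : 0 < A) (hS : IsSelfAdjoint S) (hsp : spectrum ℝ S ⊆ Icc A B)
    (hε : 0 ≤ ε) (hp : ∀ t ∈ Icc A B, |t * p.eval t ^ 2 - 1| ≤ ε) {k : H}
    (hk : ∀ f, ‖inner ℂ k f‖ ^ 2 ≤ (inner ℂ f (S f)).re) : ‖aeval S p k‖ ^ 2 ≤ 1 + ε := by
  have hunit : IsUnit S := by
    refine spectrum.isUnit_of_zero_notMem ℝ fun h0 => ?_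
    exact absurd (hsp h0).1 (not_le.2 hA)
  obtain ⟨h, hh⟩ : ∃ h, S h = k := by
    obtain ⟨u, rfl⟩ := hunit
    refine ⟨(↑u⁻¹ : H →L[ℂ] H) k, ?_⟩
    change ((u : H →L[ℂ] H) * (↑u⁻¹ : H →L[ℂ] H)) k = k
    rw [u.mul_inv]
    rfl
  set a := (inner ℂ h (S h)).re with ha
  have ha1 : a ≤ 1 := by
    have h1 := hk h
    have h2 : a ≤ ‖inner ℂ k h‖ := by
      rw [ha, hh, ← inner_conj_symm, Complex.conj_re]
      exact Complex.re_le_norm _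
    by_contra! hlt
    nlinarith
  have := re_inner_aeval_nonneg hS (q := C (1 + ε) * X - X * (X * p ^ 2)) (fun t ht => by
    have h1 := (abs_le.1 (hp t (hsp ht))).2
    have h2 := hA.trans_le (hsp ht).1
    simp only [eval_sub, eval_mul, eval_X, eval_pow, eval_C]
    nlinarith) h
  rw [re_inner_aeval_sub, ← norm_aeval_sq_of_apply_eq hS p hh, map_mul, aeval_X,
    ContinuousLinearMap.mul_def, ContinuousLinearMap.comp_apply, aeval_C_apply, inner_smul_right,
    Complex.re_ofReal_mul, ← ha] at this
  nlinarith

theorem re_inner_aeval_le (hS : IsSelfAdjoint S) (hε : 0 ≤ ε)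
    (hsp : ∀ t ∈ spectrum ℝ S, t = 0 ∨ t ∈ Icc A B)
    (hp : ∀ t ∈ Icc A B, |t * p.eval t ^ 2 - 1| ≤ ε) (f : H) :
    (inner ℂ (aeval S p f) (S (aeval S p f))).re ≤ (1 + ε) * ‖f‖ ^ 2 := by
  rw [re_inner_aeval_X_mul_sq hS]
  have := re_inner_aeval_nonneg hS (q := C (1 + ε) - X * p ^ 2) (fun t ht => by
    simp only [eval_sub, eval_mul, eval_X, eval_pow, eval_C]
    rcases hsp t ht with rfl | h
    · simp only [zero_mul, sub_zero]; linarith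
    · have := (abs_le.1 (hp t h)).2
      linarith) f
  rw [re_inner_aeval_sub, re_inner_aeval_C] at this
  linarith

/-- The given preimage `h` plays the part of `S⁻¹ k` when `S` is not invertible: `t² p² ≥ (1 - ε) t`
on the spectrum, including `t = 0`, and `⟨h, S h⟩ = 1`. -/
theorem le_norm_aeval_sq (hA : 0 < A) (hS : IsSelfAdjoint S)
    (hsp : ∀ t ∈ spectrum ℝ S, t = 0 ∨ t ∈ Icc A B)
    (hp : ∀ t ∈ Icc A B, |t * p.eval t ^ 2 - 1| ≤ ε) {h k : H} (hk : S h = k)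
    (hhk : inner ℂ h k = 1) : 1 - ε ≤ ‖aeval S p k‖ ^ 2 := by
  have := re_inner_aeval_nonneg hS (q := X * (X * p ^ 2) - C (1 - ε) * X) (fun t ht => by
    simp only [eval_sub, eval_mul, eval_X, eval_pow, eval_C]
    rcases hsp t ht with rfl | h
    · simp
    · have h1 := (abs_le.1 (hp t h)).1
      have h2 := hA.trans_le h.1
      nlinarith) h
  rw [re_inner_aeval_sub, ← norm_aeval_sq_of_apply_eq hS p hk, map_mul, aeval_X,
    ContinuousLinearMap.mul_def, ContinuousLinearMap.comp_apply, aeval_C_apply, inner_smul_right,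
    Complex.re_ofReal_mul, hk, hhk, Complex.one_re] at this
  linarith

end OperatorCalculus

/-! ### Frame operators -/

section FrameOperator

variable {G : Type*} {H : Type*} [NormedAddCommGroup H] [InnerProductSpace ℂ H] [RKHS ℂ H G ℂ]

theorem HasBesselBound.summable {B : ℝ} {P : Set G} (h : HasBesselBound H B P) (f : H) :
    Summable fun l : P => ‖f (l : G)‖ ^ 2 := by
  have h1 : ∑' l : P, ENNReal.ofReal (‖f (l : G)‖ ^ 2) ≠ ∞ := by
    refine ne_top_of_le_ne_top ENNReal.ofReal_ne_top (le_trans (le_of_eq ?_) (h f))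
    exact tsum_congr fun l => by rw [ENNReal.ofReal_pow (norm_nonneg _), ofReal_norm]
  have h2 := ENNReal.summable_toReal h1
  simpa [ENNReal.toReal_ofReal] using h2

theorem HasBesselBound.memℓp {B : ℝ} {P : Set G} (h : HasBesselBound H B P) (f : H) :
    Memℓp (fun l : P => f (l : G)) 2 := by
  refine memℓp_gen ?_
  simpa using h.summable f

theorem HasBesselBound.ofReal_tsum {B : ℝ} {P : Set G} (h : HasBesselBound H B P) (f : H) :
    ENNReal.ofReal (∑' l : P, ‖f (l : G)‖ ^ 2) = ∑' l : P, ‖f (l : G)‖ₑ ^ 2 := by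
  rw [ENNReal.ofReal_tsum_of_nonneg (fun _ => by positivity) (h.summable f)]
  exact tsum_congr fun l => by rw [ENNReal.ofReal_pow (norm_nonneg _), ofReal_norm]

theorem HasBesselBound.tsum_le {B : ℝ} (hB : 0 ≤ B) {P : Set G} (h : HasBesselBound H B P)
    (f : H) : ∑' l : P, ‖f (l : G)‖ ^ 2 ≤ B * ‖f‖ ^ 2 := by
  rw [← ENNReal.ofReal_le_ofReal_iff (by positivity), h.ofReal_tsum]
  exact h f

/-- The restriction map `H → ℓ²(P)`. -/
def HasBesselBound.restriction {B : ℝ} {P : Set G} (h : HasBesselBound H B P) :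
    H →L[ℂ] lp (fun _ : P => ℂ) 2 :=
  LinearMap.mkContinuous
    { toFun := fun f => ⟨fun l => f (l : G), h.memℓp f⟩
      map_add' := fun f g => by ext l; simp; rfl
      map_smul' := fun c f => by ext l; simp }
    √(max B 0) fun f => by
      refine le_of_sq_le_sq ?_ (by positivity)
      rw [mul_pow, Real.sq_sqrt (le_max_right _ _)]
      have h1 := lp.norm_rpow_eq_tsum (p := 2) (by norm_num)
        (⟨fun l => f (l : G), h.memℓp f⟩ : lp (fun _ : P => ℂ) 2)
      simp only [ENNReal.toReal_ofNat, Real.rpow_ofNat] at h1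
      refine h1.trans_le ?_
      refine HasBesselBound.tsum_le (le_max_right _ _) (fun g => (h g).trans ?_) f
      gcongr
      exact le_max_left _ _

@[simp]
theorem HasBesselBound.restriction_apply {B : ℝ} {P : Set G} (h : HasBesselBound H B P) (f : H)
    (l : P) : h.restriction f l = f (l : G) := rfl

variable [CompleteSpace H]

open Classical in
variable (H) in
/-- The frame operator `f ↦ ∑_{λ ∈ P} f(λ) k_λ`; it is `0` if `P` has no Bessel bound. -/
def frameOperator (P : Set G) : H →L[ℂ] H :=
  if h : ∃ B, HasBesselBound H B P then
    h.choose_spec.restriction.adjoint ∘L h.choose_spec.restriction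
  else 0

theorem HasBesselBound.frameOperator_eq {B : ℝ} {P : Set G} (h : HasBesselBound H B P) :
    frameOperator H P = h.restriction.adjoint ∘L h.restriction := by
  have hex : ∃ B, HasBesselBound H B P := ⟨B, h⟩
  rw [frameOperator, dif_pos hex]
  have : hex.choose_spec.restriction = h.restriction := by
    ext f l; rfl
  rw [this]

variable {B : ℝ} {P : Set G} (h : HasBesselBound H B P)

include h

theorem HasBesselBound.hasSum_inner_frameOperator (f g : H) :
    HasSum (fun l : P => (starRingEnd ℂ) (f (l : G)) * g (l : G))
      (inner ℂ f (frameOperator H P g)) := by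
  rw [h.frameOperator_eq, ContinuousLinearMap.comp_apply, ContinuousLinearMap.adjoint_inner_right]
  have := lp.hasSum_inner (𝕜 := ℂ) (h.restriction f) (h.restriction g)
  simp only [RCLike.inner_apply', h.restriction_apply] at this
  exact this

theorem HasBesselBound.hasSum_frameOperator (f : H) :
    HasSum (fun l : P => f (l : G) • kernelVector H (l : G)) (frameOperator H P f) := by
  classical
  have h1 := (lp.hasSum_single (p := 2) (by norm_num) (h.restriction f)).mapL
    h.restriction.adjoint
  rw [h.frameOperator_eq, ContinuousLinearMap.comp_apply]
  convert h1 using 2 with l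
  refine ext_inner_right ℂ fun g => ?_
  rw [ContinuousLinearMap.adjoint_inner_left, lp.inner_single_left, inner_smul_left,
    inner_kernelVector_left, h.restriction_apply, h.restriction_apply]
  simp [mul_comm]

theorem HasBesselBound.isSelfAdjoint_frameOperator : IsSelfAdjoint (frameOperator H P) := by
  rw [h.frameOperator_eq]
  rw [ContinuousLinearMap.isSelfAdjoint_iff', ContinuousLinearMap.adjoint_comp,
    ContinuousLinearMap.adjoint_adjoint]

theorem HasBesselBound.re_inner_frameOperator (f : H) :
    (inner ℂ f (frameOperator H P f)).re = ∑' l : P, ‖f (l : G)‖ ^ 2 := by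
  have h1 := Complex.hasSum_re (h.hasSum_inner_frameOperator f f)
  rw [← h1.tsum_eq]
  refine tsum_congr fun l => ?_
  rw [← Complex.normSq_eq_conj_mul_self, Complex.ofReal_re, Complex.normSq_eq_norm_sq]

theorem HasBesselBound.ofReal_re_inner_frameOperator (f : H) :
    ENNReal.ofReal (inner ℂ f (frameOperator H P f)).re = ∑' l : P, ‖f (l : G)‖ₑ ^ 2 := by
  rw [h.re_inner_frameOperator, h.ofReal_tsum]

theorem HasBesselBound.re_inner_frameOperator_nonneg (f : H) :
    0 ≤ (inner ℂ f (frameOperator H P f)).re := by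
  rw [h.re_inner_frameOperator]
  exact tsum_nonneg fun _ => by positivity

theorem HasBesselBound.re_inner_frameOperator_le (hB : 0 ≤ B) (f : H) :
    (inner ℂ f (frameOperator H P f)).re ≤ B * ‖f‖ ^ 2 := by
  rw [h.re_inner_frameOperator]
  exact h.tsum_le hB f

theorem HasBesselBound.norm_inner_sq_le {x : G} (hx : x ∈ P) (f : H) :
    ‖inner ℂ (kernelVector H x) f‖ ^ 2 ≤ (inner ℂ f (frameOperator H P f)).re := by
  rw [h.re_inner_frameOperator, inner_kernelVector_left]
  exact (h.summable f).le_tsum (⟨x, hx⟩ : P) fun _ _ => by positivity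

/-- The Riesz bound with coefficients `f(λ)`, in the limit of finite sums, is the operator
inequality `S² ≥ A S`. -/
theorem HasLowerRieszBound.mul_re_inner_frameOperator_le {A : ℝ} (hA : HasLowerRieszBound H A P)
    (f : H) : A * (inner ℂ f (frameOperator H P f)).re ≤ ‖frameOperator H P f‖ ^ 2 := by
  rw [h.re_inner_frameOperator]
  have h0 : Tendsto (fun t : Finset P => ∑ l ∈ t, ‖f (l : G)‖ ^ 2) atTop
    (𝓝 (∑' l : P, ‖f (l : G)‖ ^ 2)) := (h.summable f).hasSum
  have h2 : Tendsto (fun t : Finset P => ∑ l ∈ t, f (l : G) • kernelVector H (l : G)) atTop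
    (𝓝 (frameOperator H P f)) := h.hasSum_frameOperator f
  refine le_of_tendsto_of_tendsto (h0.const_mul A) (h2.norm.pow 2)
    (Eventually.of_forall fun t => ?_)
  have h1 := hA (t.map (Function.Embedding.subtype (· ∈ P))) id (injOn_id _) (fun y hy => by
    obtain ⟨z, -, rfl⟩ := Finset.mem_map.1 hy
    exact z.2) f
  rwa [Finset.sum_map, Finset.sum_map] at h1

/-- Under a lower Riesz bound, there is an element biorthogonal to the kernel vectors of `P`. -/
theorem HasLowerRieszBound.exists_biorthogonal {A : ℝ} (hA0 : 0 < A)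
    (hA : HasLowerRieszBound H A P) {x : G} (hx : x ∈ P) :
    ∃ u : H, frameOperator H P u = kernelVector H x ∧ inner ℂ u (kernelVector H x) = 1 := by
  classical
  let V : Submodule ℂ H := Submodule.span ℂ ((fun y => kernelVector H y) '' (P \ {x}))
  let W : Submodule ℂ H := V.topologicalClosure
  have hWc : IsClosed (W : Set H) := V.isClosed_topologicalClosure
  have : CompleteSpace W := hWc.completeSpace_coe
  set k := kernelVector H x with hk
  -- The coefficient `1` at `x` alone contributes `A` to the Riesz bound, so `k_x` stays away from
  -- the span of the other kernel vectors.
  have hV : ∀ v ∈ V, A ≤ ‖k - v‖ ^ 2 := by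
    intro v hv
    obtain ⟨t, c, ht, hc⟩ : ∃ (t : Finset G) (c : G → ℂ), (t : Set G) ⊆ P \ {x} ∧
        ∑ y ∈ t, c y • kernelVector H y = v := by
      obtain ⟨c, hc, rfl⟩ := (Finsupp.mem_span_image_iff_linearCombination ℂ).1 hv
      exact ⟨c.support, c, (Finsupp.mem_supported ℂ c).1 hc, rfl⟩
    have hxt : x ∉ t := fun hxt => (ht hxt).2 rfl
    have h1 := hA (insert x t) id (injOn_id _) (fun y hy => by
      rcases Finset.mem_insert.1 hy with rfl | hy
      · exact hx
      · exact (ht hy).1) (fun y => if y = x then 1 else -c y)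
    rw [Finset.sum_insert hxt, Finset.sum_insert hxt] at h1
    have h2 : ∑ y ∈ t, (if y = x then (1 : ℂ) else -c y) • kernelVector H (id y) = -v := by
      rw [← hc, ← Finset.sum_neg_distrib]
      refine Finset.sum_congr rfl fun y hy => ?_
      rw [if_neg (fun hyx : y = x => hxt (hyx ▸ hy)), neg_smul, id]
    rw [h2] at h1
    simp only [if_true, norm_one, one_smul, id] at h1
    rw [← sub_eq_add_neg] at h1
    have h3 : 0 ≤ ∑ y ∈ t, ‖if y = x then (1 : ℂ) else -c y‖ ^ 2 :=
      Finset.sum_nonneg fun _ _ => by positivity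
    nlinarith
  have hW : ∀ v ∈ W, A ≤ ‖k - v‖ ^ 2 := by
    intro v hv
    have hcl : IsClosed {v : H | A ≤ ‖k - v‖ ^ 2} :=
      isClosed_le continuous_const ((continuous_const.sub continuous_id).norm.pow 2)
    exact closure_minimal (fun v hv => hV v hv) hcl hv
  set p : H := W.starProjection k with hp
  have hpW : p ∈ W := W.starProjection_apply_mem k
  set d : H := k - p with hd
  have hd0 : A ≤ ‖d‖ ^ 2 := hW p hpW
  have hdpos : 0 < ‖d‖ ^ 2 := hA0.trans_le hd0
  have hdW : ∀ v ∈ W, inner ℂ v d = 0 := fun v hv =>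
    (W.sub_starProjection_mem_orthogonal k) v hv
  have hdk : inner ℂ k d = (‖d‖ ^ 2 : ℝ) := by
    have : k = d + p := by rw [hd]; abel
    nth_rw 1 [this]
    rw [inner_add_left, hdW p hpW, add_zero, inner_self_eq_norm_sq_to_K]
    simp
  have hne : ((‖d‖ ^ 2 : ℝ) : ℂ) ≠ 0 := Complex.ofReal_ne_zero.2 hdpos.ne'
  -- The normalized component of `k_x` orthogonal to the other kernel vectors: `u(x) = 1` and `u =
  -- 0` on the rest of `P`, so the series for `S u` reduces to `k_x`.
  set u : H := ((‖d‖ ^ 2 : ℝ) : ℂ)⁻¹ • d with hu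
  have hku : inner ℂ k u = 1 := by
    rw [hu, inner_smul_right, hdk, inv_mul_cancel₀ hne]
  have hux : u x = 1 := by rw [← inner_kernelVector_left]; exact hku
  have huy : ∀ y ∈ P, y ≠ x → u y = 0 := by
    intro y hy hyx
    rw [← inner_kernelVector_left, hu, inner_smul_right, hdW, mul_zero]
    exact subset_closure (Submodule.subset_span ⟨y, ⟨hy, hyx⟩, rfl⟩)
  refine ⟨u, ?_, by rw [← inner_conj_symm, hku, map_one]⟩
  have h1 := h.hasSum_frameOperator u
  have h2 : HasSum (fun l : P => u (l : G) • kernelVector H (l : G)) k := by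
    have := hasSum_single (f := fun l : P => u (l : G) • kernelVector H (l : G)) ⟨x, hx⟩
      (fun y hy => by rw [huy y y.2 (fun hyx => hy (Subtype.ext hyx)), zero_smul])
    simpa [hux] using this
  exact h1.unique h2

end FrameOperator

/-! ### Covariance of frame operators under twisted translation -/

section Covariance

open Polynomial

variable {G : Type*} [Group G] [TopologicalSpace G] [IsTopologicalGroup G]
  [LocallyCompactSpace G] [SecondCountableTopology G] [T2Space G]
  [MeasurableSpace G] [BorelSpace G]
  {m : Measure G} [m.IsHaarMeasure] {σ : G → G → Circle} (hσ : IsContinuousTwoCocycle σ)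
  {H : Type*} [NormedAddCommGroup H] [InnerProductSpace ℂ H] [CompleteSpace H] [RKHS ℂ H G ℂ]
  (hL2 : IsIsometricInL2 H m) (hinv : IsTwistedInvariant H σ)

theorem HasBesselBound.frameOperator_smul {B : ℝ} {P : Set G} (h : HasBesselBound H B P) (x : G)
    (f : H) : frameOperator H (x • P) (twistedShift hσ hL2 hinv x f) =
      twistedShift hσ hL2 hinv x (frameOperator H P f) := by
  refine ext_inner_left ℂ fun g => ?_
  obtain ⟨g, rfl⟩ := (twistedShift hσ hL2 hinv x).surjective g
  rw [LinearIsometryEquiv.inner_map_map]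
  have h1 := (h.smul hσ hL2 hinv x).hasSum_inner_frameOperator (twistedShift hσ hL2 hinv x g)
    (twistedShift hσ hL2 hinv x f)
  let e : P ≃ (x • P : Set G) := Equiv.Set.image (fun y => x • y) _ (MulAction.injective x)
  rw [← e.hasSum_iff] at h1
  refine h1.unique ?_
  convert h.hasSum_inner_frameOperator g f using 2 with l
  change (starRingEnd ℂ) (twistedShift hσ hL2 hinv x g (x * l)) *
    twistedShift hσ hL2 hinv x f (x * l) = _
  rw [twistedShift_apply, twistedShift_apply, inv_mul_cancel_left, map_mul,
    ← Circle.coe_inv_eq_conj, mul_mul_mul_comm, ← Circle.coe_mul, inv_mul_cancel, Circle.coe_one,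
    one_mul]

theorem HasBesselBound.aeval_frameOperator_smul {B : ℝ} {P : Set G} (h : HasBesselBound H B P)
    (x : G) (p : ℝ[X]) (f : H) :
    aeval (frameOperator H (x • P)) p (twistedShift hσ hL2 hinv x f) =
      twistedShift hσ hL2 hinv x (aeval (frameOperator H P) p f) := by
  induction p using Polynomial.induction_on generalizing f with
  | C a => rw [aeval_C_apply, aeval_C_apply, map_smul]
  | add p q hp hq => rw [map_add, map_add, add_apply, add_apply, hp, hq, map_add]
  | monomial n a ih =>
    have hmul : ∀ (S : H →L[ℂ] H) (g : H),
        aeval S (C a * X ^ (n + 1)) g = aeval S (C a * X ^ n) (S g) := fun S g => by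
      rw [pow_succ, ← mul_assoc, map_mul _ _ X, aeval_X]
      rfl
    rw [hmul, hmul, h.frameOperator_smul hσ hL2 hinv, ih]

include hσ hL2 hinv in
/-- The values at `x⁻¹` for `x⁻¹ • P` and at `x` for `P` have the same modulus. -/
theorem HasBesselBound.norm_aeval_frameOperator_inv_smul {B : ℝ} {P : Set G}
    (h : HasBesselBound H B P) (p : ℝ[X]) (x : G) :
    ‖aeval (frameOperator H (x⁻¹ • P)) p (kernelVector H (1 : G)) x⁻¹‖ =
      ‖aeval (frameOperator H P) p (kernelVector H (1 : G)) x‖ := by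
  -- Covariance turns the value at `x⁻¹` into `⟨k_e, p(S_P) k_x⟩` up to a phase, and
  -- self-adjointness moves `p(S_P)` onto `k_e`.
  have h1 := (h.smul hσ hL2 hinv x⁻¹).aeval_frameOperator_smul hσ hL2 hinv x p (kernelVector H 1)
  rw [smul_inv_smul, twistedShift_kernelVector_one] at h1
  have h2 := norm_twistedShift_apply hσ hL2 hinv x
    (aeval (frameOperator H (x⁻¹ • P)) p (kernelVector H (1 : G))) 1
  rw [mul_one, ← h1] at h2
  rw [← h2, ← inner_kernelVector_left, ← inner_kernelVector_left, ← inner_conj_symm,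
    RCLike.norm_conj, ← ContinuousLinearMap.adjoint_inner_right,
    (isSelfAdjoint_aeval h.isSelfAdjoint_frameOperator p).adjoint_eq]

end Covariance

/-! ### Measurability and the averaged identity -/

section Unimodular

variable {G : Type*} [Group G] [TopologicalSpace G] [IsTopologicalGroup G]
  [LocallyCompactSpace G] [SecondCountableTopology G] [T2Space G]
  [MeasurableSpace G] [BorelSpace G]

/-- A bi-invariant Haar measure is invariant under inversion. -/
theorem isInvInvariant_of_isMulRightInvariant (m : Measure G) [m.IsHaarMeasure]
    [m.IsMulRightInvariant] : m.IsInvInvariant := by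
  have h1 : m.inv = m.inv.haarScalarFactor m • m := Measure.isMulLeftInvariant_eq_smul m.inv m
  obtain ⟨V, hV, hV1⟩ := exists_compact_mem_nhds (1 : G)
  have hW1 : V ∩ V⁻¹ ∈ 𝓝 (1 : G) := inter_mem hV1 (inv_mem_nhds_one G hV1)
  -- A symmetric compact neighbourhood has the same measure under `m` and `m.inv`, which forces
  -- their ratio to be `1`.
  have hWc : IsCompact (V ∩ V⁻¹) := hV.inter_right hV.inv.isClosed
  have h2 : m.inv (V ∩ V⁻¹) = m (V ∩ V⁻¹) := by
    rw [Measure.inv_apply, inter_inv, inv_inv, inter_comm]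
  have h3 : (m.inv.haarScalarFactor m : ℝ≥0∞) = 1 := by
    rw [h1, Measure.smul_apply] at h2
    have h0 : m (V ∩ V⁻¹) ≠ 0 := (Measure.measure_pos_of_mem_nhds m hW1).ne'
    have h4 : (m.inv.haarScalarFactor m : ℝ≥0∞) * m (V ∩ V⁻¹) = 1 * m (V ∩ V⁻¹) := by
      rw [one_mul]; exact h2
    exact (ENNReal.mul_left_inj h0 hWc.measure_ne_top).1 h4
  refine ⟨?_⟩
  rw [h1, ENNReal.coe_eq_one.1 h3, one_smul]

end Unimodular

section Measurability

theorem IsSeparatedBy.countable {G : Type*} [Group G] [TopologicalSpace G] [IsTopologicalGroup G]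
    [SecondCountableTopology G] {U P : Set G} {ℓ : ℕ} (h : IsSeparatedBy U ℓ P) (hU : IsOpen U)
    (h1 : (1 : G) ∈ U) : P.Countable := by
  obtain ⟨x, hx⟩ := exists_seq_iUnion_smul_eq_univ hU h1
  rw [← inter_univ P, ← hx, inter_iUnion]
  exact countable_iUnion fun n =>
    (finite_of_encard_le_coe (h (x n))).countable

open Polynomial ProbabilityTheory

theorem integral_pointMeasure {G E : Type*} [MeasurableSpace G] [MeasurableSingletonClass G]
    [NormedAddCommGroup E] [NormedSpace ℝ E] [FiniteDimensional ℝ E] (P : Set G) [Countable P]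
    (f : G → E) : ∫ x, f x ∂pointMeasure P = ∑' x : P, f x := by
  have := integral_sum_dirac (f := f) (c := fun _ : P => 1) (x := fun y : P => (y : G))
    (fun _ => ENNReal.one_ne_top)
  simpa [pointMeasure] using this

variable {G : Type*} [Group G] [TopologicalSpace G] [IsTopologicalGroup G]
  [LocallyCompactSpace G] [SecondCountableTopology G] [T2Space G]
  [MeasurableSpace G] [BorelSpace G]
  {m : Measure G} [m.IsHaarMeasure] {σ : G → G → Circle} (hσ : IsContinuousTwoCocycle σ)
  {H : Type*} [NormedAddCommGroup H] [InnerProductSpace ℂ H] [CompleteSpace H] [RKHS ℂ H G ℂ]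
  (hL2 : IsIsometricInL2 H m) (hinv : IsTwistedInvariant H σ)

include hσ hL2 hinv

theorem measurable_uncurry_coe {X : Type*} [MeasurableSpace X] {g : X → H}
    (hg : ∀ y : G, Measurable fun P => g P y) :
    Measurable (Function.uncurry fun (y : G) (P : X) => g P y) :=
  measurable_uncurry_of_continuous_of_measurable
    (fun P => continuous_coe hσ hL2 hinv (g P)) hg

/-- `⟨k_y, S_P g⟩` is the integral of a jointly measurable function against the point kernel.
Letting the vector `g` vary with `P` allows iteration to powers of `S_P`. -/
theorem measurable_frameOperator_apply {Λ : Set G} {B : ℝ} (h : IsRelativelySeparated Λ)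
    (hB : HasBesselBound H B Λ) {g : puncturedHull Λ → H} (hg : ∀ y : G, Measurable fun P => g P y)
    (y : G) : Measurable fun P : puncturedHull Λ =>
      frameOperator H ((P : ClosedSubsets G) : Set G) (g P) y := by
  obtain ⟨κ, hκ, hκP⟩ := exists_pointKernel h
  obtain ⟨U, hU, hU1, ℓ, hℓ⟩ := h.exists_isSeparatedBy
  have h1 : (fun P : puncturedHull Λ => frameOperator H ((P : ClosedSubsets G) : Set G) (g P) y) =
      fun P => ∫ x, (starRingEnd ℂ) (kernelVector H y x) * g P x ∂κ P := by
    funext P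
    have : Countable ((P : ClosedSubsets G) : Set G) :=
      ((hℓ.of_mem_hull hU P.2.1).countable hU hU1).to_subtype
    rw [hκP, integral_pointMeasure, ← inner_kernelVector_left]
    exact ((hB.of_mem_hull hσ hL2 hinv P.2.1).hasSum_inner_frameOperator _ _).tsum_eq.symm
  rw [h1]
  have h2 := (measurable_uncurry_coe hσ hL2 hinv hg).comp measurable_swap
  have h3 : Measurable fun q : puncturedHull Λ × G =>
      (starRingEnd ℂ) (kernelVector H y q.2) * g q.1 q.2 :=
    ((Complex.continuous_conj.comp
      (continuous_coe hσ hL2 hinv (kernelVector H y))).measurable.comp measurable_snd).mul h2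
  exact (h3.stronglyMeasurable.integral_kernel_prod_right' (κ := κ)).measurable

theorem measurable_aeval_frameOperator_apply {Λ : Set G} {B : ℝ} (h : IsRelativelySeparated Λ)
    (hB : HasBesselBound H B Λ) (p : ℝ[X]) {g : puncturedHull Λ → H}
    (hg : ∀ y : G, Measurable fun P => g P y) (y : G) :
    Measurable fun P : puncturedHull Λ =>
      aeval (frameOperator H ((P : ClosedSubsets G) : Set G)) p (g P) y := by
  simp only [← inner_kernelVector_left] at hg ⊢
  induction p using Polynomial.induction_on generalizing g with
  | C a =>
    simp only [aeval_C_apply, inner_smul_right]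
    exact (hg y).const_mul _
  | add p q hp hq =>
    simp only [map_add, add_apply, inner_add_right]
    exact (hp hg).add (hq hg)
  | monomial n a ih =>
    have hmul : ∀ (S : H →L[ℂ] H) (f : H),
        aeval S (C a * X ^ (n + 1)) f = aeval S (C a * X ^ n) (S f) := fun S f => by
      rw [pow_succ, ← mul_assoc, map_mul _ _ X, aeval_X]
      rfl
    simp only [hmul]
    refine ih fun z => ?_
    simp only [inner_kernelVector_left] at hg ⊢
    exact measurable_frameOperator_apply hσ hL2 hinv h hB hg z

/-- For `v_P = p(S_P) k_e`, the mean of `⟨v_P, S_P v_P⟩` over the hull is the mean of `‖v_Q‖²` over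
the transversal, which carries the measure `ρ` of total mass `μ₀(Ω₀(Λ))`. -/
theorem exists_lintegral_re_inner_eq_lintegral_norm [m.IsMulRightInvariant] {Λ : Set G} {B : ℝ}
    (h : IsRelativelySeparated Λ) (hB : HasBesselBound H B Λ) (μ : Measure (puncturedHull Λ))
    [IsFiniteMeasure μ] [SMulInvariantMeasure G (puncturedHull Λ) μ] :
    ∃ ρ : Measure (puncturedHull Λ), IsFiniteMeasure ρ ∧
      (∀ᵐ Q : puncturedHull Λ ∂ρ, (1 : G) ∈ (Q : ClosedSubsets G)) ∧
      transverseMeasure m Λ μ univ = ρ univ ∧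
      ∀ p : ℝ[X],
        ∫⁻ P : puncturedHull Λ, ENNReal.ofReal (inner ℂ
          (aeval (frameOperator H ((P : ClosedSubsets G) : Set G)) p (kernelVector H (1 : G)))
          (frameOperator H ((P : ClosedSubsets G) : Set G)
            (aeval (frameOperator H ((P : ClosedSubsets G) : Set G)) p
              (kernelVector H (1 : G))))).re ∂μ =
        ∫⁻ Q : puncturedHull Λ, ENNReal.ofReal (‖aeval (frameOperator H
          ((Q : ClosedSubsets G) : Set G)) p (kernelVector H (1 : G))‖ ^ 2) ∂ρ := by
  have := isInvInvariant_of_isMulRightInvariant m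
  obtain ⟨ρ, hρ, hρ1, hρu, hρF⟩ := exists_disintegration_transverseMeasure m h μ
  refine ⟨ρ, hρ, by rw [ae_iff]; exact hρ1, hρu, fun p => ?_⟩
  have hF := hρF (fun x Q => ‖aeval (frameOperator H ((Q : ClosedSubsets G) : Set G)) p
    (kernelVector H (1 : G)) x⁻¹‖ₑ ^ 2) (by
      have h1 := measurable_uncurry_coe hσ hL2 hinv
        (measurable_aeval_frameOperator_apply hσ hL2 hinv h hB p
          (g := fun _ => kernelVector H (1 : G)) fun y => measurable_const)
      exact ((h1.comp (measurable_fst.inv.prodMk measurable_snd)).enorm).pow_const 2)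
  convert hF using 1
  · refine lintegral_congr fun P => ?_
    have hP := hB.of_mem_hull hσ hL2 hinv P.2.1
    rw [hP.ofReal_re_inner_frameOperator]
    refine tsum_congr fun x => ?_
    rw [← ofReal_norm, ← hP.norm_aeval_frameOperator_inv_smul hσ hL2 hinv p x, ofReal_norm]
    rfl
  · refine lintegral_congr fun Q => ?_
    set v := aeval (frameOperator H ((Q : ClosedSubsets G) : Set G)) p (kernelVector H (1 : G))
    -- Unimodularity removes the inversion, and the isometric embedding identifies the integral with
    -- `‖v‖²`.
    rw [lintegral_inv_eq_self (μ := m) (fun x => ‖v x‖ₑ ^ 2), ENNReal.ofReal_pow (norm_nonneg _),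
      ofReal_norm, ← (hL2 v).2]
    have := eLpNorm_nnreal_pow_eq_lintegral (p := 2) (f := (v : G → ℂ)) (μ := m) (by norm_num)
    simpa using this

end Measurability

/-! ### The covolume inequalities -/

theorem le_of_forall_one_sub_mul_le {a b : ℝ} (hb : 0 ≤ b)
    (h : ∀ ε > 0, (1 - ε) * a ≤ (1 + ε) * b) : a ≤ b := by
  by_contra! hab
  have hpos : 0 < a + b := by linarith
  -- This `ε` satisfies `ε (a + b) = (a - b) / 2 < a - b`, contrary to the hypothesis.
  have h1 := h ((a - b) / (2 * (a + b))) (div_pos (by linarith) (by linarith))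
  have h2 : (a - b) / (2 * (a + b)) * (a + b) = (a - b) / 2 := by field_simp
  nlinarith

section Covolume

open Polynomial

variable {G : Type*} [Group G] [TopologicalSpace G] [IsTopologicalGroup G]
  [LocallyCompactSpace G] [SecondCountableTopology G] [T2Space G]
  [MeasurableSpace G] [BorelSpace G]
  {m : Measure G} [m.IsHaarMeasure] [m.IsMulRightInvariant]
  {σ : G → G → Circle} (hσ : IsContinuousTwoCocycle σ)
  {H : Type*} [NormedAddCommGroup H] [InnerProductSpace ℂ H] [CompleteSpace H] [RKHS ℂ H G ℂ]
  (hL2 : IsIsometricInL2 H m) (hinv : IsTwistedInvariant H σ) (hloc : IsLocalized H m)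

include hσ hL2 hinv

include hloc in
theorem enorm_kernelVector_sq_le_transverseMeasure {Λ : Set G} {A B : ℝ} (hA : 0 < A) (hB : 0 ≤ B)
    (h : IsRelativelySeparated Λ) (hΛA : HasLowerSamplingBound H A Λ)
    (hΛB : HasBesselBound H B Λ) (μ : Measure (puncturedHull Λ)) [IsProbabilityMeasure μ]
    [SMulInvariantMeasure G (puncturedHull Λ) μ] :
    ‖kernelVector H (1 : G)‖ₑ ^ 2 ≤ transverseMeasure m Λ μ univ := by
  obtain ⟨U, hU, hU1, ℓ, hℓ⟩ := h.exists_isSeparatedBy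
  have hPB : ∀ P : puncturedHull Λ, HasBesselBound H B ((P : ClosedSubsets G) : Set G) :=
    fun P => hΛB.of_mem_hull hσ hL2 hinv P.2.1
  -- On the hull the lower bound drops by the multiplicity `ℓ`. The `+ 1` covers `ℓ = 0`, and the
  -- exact constant does not matter.
  have hA' : 0 < A / (ℓ + 1) := by positivity
  have hPA : ∀ (P : puncturedHull Λ) (f : H),
      A / (ℓ + 1) * ‖f‖ ^ 2 ≤ (inner ℂ f (frameOperator H ((P : ClosedSubsets G) : Set G) f)).re := by
    intro P f
    have h1 := hΛA.of_mem_hull hσ hL2 hinv hloc hU hU1 hℓ P.2.1 f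
    have h0 := (hPB P).re_inner_frameOperator_nonneg f
    rw [← (hPB P).ofReal_re_inner_frameOperator, ← ENNReal.ofReal_natCast,
      ← ENNReal.ofReal_mul (by positivity), ENNReal.ofReal_le_ofReal_iff (by positivity)] at h1
    rw [div_mul_eq_mul_div, div_le_iff₀ (by positivity)]
    linarith
  have hsp := fun P : puncturedHull Λ => spectrum_subset_Icc
    (hPB P).isSelfAdjoint_frameOperator (hPA P) ((hPB P).re_inner_frameOperator_le hB)
  obtain ⟨ρ, hρ, hρ1, hρu, hid⟩ :=
    exists_lintegral_re_inner_eq_lintegral_norm hσ hL2 hinv h hΛB μ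
  rw [hρu, ← ofReal_norm, ← ENNReal.ofReal_pow (norm_nonneg _), ← ofReal_measureReal]
  refine ENNReal.ofReal_le_ofReal (le_of_forall_one_sub_mul_le measureReal_nonneg fun ε hε => ?_)
  obtain ⟨p, hp⟩ := exists_polynomial_mul_sq_near_one (B := B) hA' hε
  have hlow := lintegral_mono (μ := μ) fun P : puncturedHull Λ => ENNReal.ofReal_le_ofReal
    (le_re_inner_aeval (hPB P).isSelfAdjoint_frameOperator (hsp P) hp (kernelVector H (1 : G)))
  have hup : ∫⁻ Q : puncturedHull Λ, ENNReal.ofReal (‖aeval (frameOperator H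
      ((Q : ClosedSubsets G) : Set G)) p (kernelVector H (1 : G))‖ ^ 2) ∂ρ ≤
      ∫⁻ _, ENNReal.ofReal (1 + ε) ∂ρ := lintegral_mono_ae <| by
    filter_upwards [hρ1] with Q hQ
    exact ENNReal.ofReal_le_ofReal (norm_aeval_sq_le hA' (hPB Q).isSelfAdjoint_frameOperator
      (hsp Q) hε.le hp fun f => (hPB Q).norm_inner_sq_le hQ f)
  have h1 := (hlow.trans (hid p).le).trans hup
  rwa [lintegral_const, lintegral_const, measure_univ (μ := μ), mul_one,
    ← ofReal_measureReal (μ := ρ),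
    ← ENNReal.ofReal_mul (by positivity), ENNReal.ofReal_le_ofReal_iff (by positivity)] at h1

theorem transverseMeasure_le_enorm_kernelVector_sq {Λ : Set G} {A B : ℝ} (hA : 0 < A) (hB : 0 ≤ B)
    (h : IsRelativelySeparated Λ) (hΛA : HasLowerRieszBound H A Λ)
    (hΛB : HasBesselBound H B Λ) (μ : Measure (puncturedHull Λ)) [IsProbabilityMeasure μ]
    [SMulInvariantMeasure G (puncturedHull Λ) μ] :
    transverseMeasure m Λ μ univ ≤ ‖kernelVector H (1 : G)‖ₑ ^ 2 := by
  have hPB : ∀ P : puncturedHull Λ, HasBesselBound H B ((P : ClosedSubsets G) : Set G) :=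
    fun P => hΛB.of_mem_hull hσ hL2 hinv P.2.1
  have hPA : ∀ P : puncturedHull Λ, HasLowerRieszBound H A ((P : ClosedSubsets G) : Set G) :=
    fun P => hΛA.of_mem_hull hσ hL2 hinv P.2.1
  have hsp : ∀ P : puncturedHull Λ, ∀ t ∈ spectrum ℝ
      (frameOperator H ((P : ClosedSubsets G) : Set G)), t = 0 ∨ t ∈ Icc A B := fun P t ht =>
    eq_zero_or_mem_Icc_of_mem_spectrum (hPB P).isSelfAdjoint_frameOperator
      (hPB P).re_inner_frameOperator_nonneg
      (HasLowerRieszBound.mul_re_inner_frameOperator_le (hPB P) (hPA P))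
      ((hPB P).re_inner_frameOperator_le hB) ht
  obtain ⟨ρ, hρ, hρ1, hρu, hid⟩ :=
    exists_lintegral_re_inner_eq_lintegral_norm hσ hL2 hinv h hΛB μ
  rw [hρu, ← ofReal_norm, ← ENNReal.ofReal_pow (norm_nonneg _), ← ofReal_measureReal]
  refine ENNReal.ofReal_le_ofReal (le_of_forall_one_sub_mul_le (by positivity) fun ε hε => ?_)
  obtain ⟨p, hp⟩ := exists_polynomial_mul_sq_near_one (B := B) hA hε
  have hup := lintegral_mono (μ := μ) fun P : puncturedHull Λ => ENNReal.ofReal_le_ofReal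
    (re_inner_aeval_le (hPB P).isSelfAdjoint_frameOperator hε.le (hsp P) hp
      (kernelVector H (1 : G)))
  have hlow : ∫⁻ _, ENNReal.ofReal (1 - ε) ∂ρ ≤
      ∫⁻ Q : puncturedHull Λ, ENNReal.ofReal (‖aeval (frameOperator H
        ((Q : ClosedSubsets G) : Set G)) p (kernelVector H (1 : G))‖ ^ 2) ∂ρ :=
    lintegral_mono_ae <| by
      filter_upwards [hρ1] with Q hQ
      -- Here `e ∈ Q` is essential: `k_e` is then a member of the Riesz sequence and has a
      -- biorthogonal vector.
      obtain ⟨u, hu, hu1⟩ := HasLowerRieszBound.exists_biorthogonal (hPB Q) hA (hPA Q) hQ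
      exact ENNReal.ofReal_le_ofReal (le_norm_aeval_sq hA (hPB Q).isSelfAdjoint_frameOperator
        (hsp Q) hp hu hu1)
  have h1 := (hlow.trans (hid p).ge).trans hup
  rwa [lintegral_const, lintegral_const, measure_univ (μ := μ), mul_one,
    ← ofReal_measureReal (μ := ρ),
    ← ENNReal.ofReal_mul' measureReal_nonneg, ENNReal.ofReal_le_ofReal_iff (by positivity)] at h1

include hloc in
theorem IsSetOfSampling.enorm_sq_mul_upperCovolume_le [Nontrivial H] {Λ : Set G}
    (h : IsSetOfSampling H Λ) : IsRelativelySeparated Λ ∧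
      ‖kernelVector H (1 : G)‖ₑ ^ 2 * upperCovolume m Λ ≤ 1 := by
  obtain ⟨A, B, hA, hB, hAB⟩ := h
  have hΛB : HasBesselBound H B Λ := fun f => (hAB f).2
  have hsep := hΛB.isRelativelySeparated hσ hL2 hinv
  refine ⟨hsep, ?_⟩
  simp only [upperCovolume, ENNReal.mul_iSup]
  refine iSup₂_le fun μ hμ => ?_
  have := hμ.1
  have := hμ.2
  rw [_root_.covolume, measure_univ, mul_one_div]
  exact (ENNReal.div_le_div_right (enorm_kernelVector_sq_le_transverseMeasure hσ hL2 hinv hloc hA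
    hB.le hsep (fun f => (hAB f).1) hΛB μ) _).trans ENNReal.div_self_le_one

include hloc in
theorem IsSetOfInterpolation.le_enorm_sq_mul_lowerCovolume [Nontrivial H] {Λ : Set G}
    (h : IsSetOfInterpolation H Λ) : IsRelativelySeparated Λ ∧
      1 ≤ ‖kernelVector H (1 : G)‖ₑ ^ 2 * lowerCovolume m Λ := by
  obtain ⟨A, hA, hΛA⟩ := h.exists_hasLowerRieszBound
  have hsep := hΛA.isRelativelySeparated hσ hL2 hinv hA
  -- Interpolation provides no upper bound by itself. It comes from separation and localization.
  obtain ⟨B, hB, hΛB⟩ := exists_hasBesselBound (H := H)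
    (fun f => hsep.tsum_lt_top hσ hL2 hinv hloc f)
  refine ⟨hsep, ?_⟩
  have h0 : ‖kernelVector H (1 : G)‖ₑ ^ 2 ≠ 0 :=
    pow_ne_zero 2 (enorm_ne_zero.2 (kernelVector_one_ne_zero hσ hL2 hinv))
  have htop : ‖kernelVector H (1 : G)‖ₑ ^ 2 ≠ ∞ := ENNReal.pow_ne_top enorm_ne_top
  rw [mul_comm, ← ENNReal.div_le_iff h0 htop, lowerCovolume]
  refine le_iInf₂ fun μ hμ => ?_
  have := hμ.1
  have := hμ.2
  rw [_root_.covolume, measure_univ]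
  exact ENNReal.div_le_div_left
    (transverseMeasure_le_enorm_kernelVector_sq hσ hL2 hinv hA hB.le hsep hΛA hΛB μ) _

end Covolume

end

theorem theorem1p2 {G : Type*} [Group G] [TopologicalSpace G] [IsTopologicalGroup G]
    [LocallyCompactSpace G] [SecondCountableTopology G] [T2Space G]
    [MeasurableSpace G] [BorelSpace G]
    -- a Haar measure on the unimodular group `G`
    (m : Measure G) [m.IsHaarMeasure] [m.IsMulRightInvariant]
    (σ : G → G → Circle) (hσ : IsContinuousTwoCocycle σ)
    (H : Type*) [NormedAddCommGroup H] [InnerProductSpace ℂ H] [CompleteSpace H] [Nontrivial H]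
    [RKHS ℂ H G ℂ]
    (hL2 : IsIsometricInL2 H m) (hinv : IsTwistedInvariant H σ) (hloc : IsLocalized H m)
    (Λ : Set G) :
    -- `RKHS.kerFun H 1 1` is the vector `k_e`
    (IsSetOfSampling H Λ → IsRelativelySeparated Λ ∧
      ‖RKHS.kerFun H (1 : G) (1 : ℂ)‖ₑ ^ 2 * upperCovolume m Λ ≤ 1) ∧
    (IsSetOfInterpolation H Λ → IsRelativelySeparated Λ ∧
      1 ≤ ‖RKHS.kerFun H (1 : G) (1 : ℂ)‖ₑ ^ 2 * lowerCovolume m Λ) := by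
  exact ⟨fun h => h.enorm_sq_mul_upperCovolume_le hσ hL2 hinv hloc,
    fun h => h.le_enorm_sq_mul_lowerCovolume hσ hL2 hinv hloc⟩
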